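/- Let $(R,\mathfrak m)$ be a Noetherian local ring of dimension $d$. A parameter ideal of $R$ is an ideal generated by a system of parameters, i.e. by $d$ elements $x_1,\dots,x_d$ such that $(x_1,\dots,x_d)$ is $\mathfrak m$-primary. For an $\mathfrak m$-primary ideal $I$, the Hilbert coefficients $e_0(I),\dots,e_d(I)\in\mathbb Z$ are determined by $$\ell(R/I^{n+1})=\sum_{i=0}^{d}(-1)^i e_i(I)\binom{n+d-i}{d-i}\qquad\text{for all } n\gg 0,$$ where $\ell$ denotes length (and $e_1(I)=0$ if $d=0$). The limit closure of a parameter ideal $Q=(x_1,\dots,x_d)$ is $$Q^{\lim}=\bigcup_{n\ge 0}\bigl((x_1^{n+1},\dots,x_d^{n+1}):_R (x_1\cdots x_d)^n\bigr),$$ which does not depend on the choice of the generators $x_1,\dots,x_d$ of $Q$. The ring $R$ is called Buchsbaum if $\ell(R/Q)-e_0(Q)$ has the same value for all parameter ideals $Q$ of $R$, and it satisfies $(S_2)$ if $\operatorname{depth}R_{\mathfrak p}\ge\min\{2,\dim R_{\mathfrak p}\}$ for every prime ideal $\mathfrak p$ of $R$. Suppose that $R$ is Buchsbaum and satisfies $(S_2)$.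 Then for every parameter ideal $Q$ of $R$ $$e_0(Q)-\ell(R/Q^{\lim})+e_1(Q)\ge 0.$$ Moreover, if equality holds for some parameter ideal $Q$ of $R$, then $R$ is Cohen–Macaulay. -/

import Mathlib

noncomputable section

universe u

/-- The length of an `R`-module as an integer. It is only used for quotients of a Noetherian local
ring by ideals containing a power of a parameter ideal, where the length is finite. -/
def lengthInt (R : Type u) [CommRing R] (M : Type u) [AddCommGroup M] [Module R M] : ℤ :=
  ((Module.length R M).toNat : ℤ)

/-- `x₁, …, x_d` is a system of parameters of the local ring `R`: `d = dim R` and the ideal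
`(x₁, …, x_d)` is primary to the maximal ideal. -/
def IsSystemOfParameters {R : Type u} [CommRing R] [IsLocalRing R] {d : ℕ} (x : Fin d → R) :
    Prop :=
  ringKrullDim R = (d : WithBot ℕ∞) ∧
    (Ideal.span (Set.range x)).radical = IsLocalRing.maximalIdeal R

/-- A parameter ideal is an ideal generated by a system of parameters. -/
def IsParameterIdeal {R : Type u} [CommRing R] [IsLocalRing R] (Q : Ideal R) : Prop :=
  ∃ (d : ℕ) (x : Fin d → R), IsSystemOfParameters x ∧ Q = Ideal.span (Set.range x)

/-- `e₀, …, e_d` (continued by zero) are the Hilbert coefficients of `I`, where `d = dim R`: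
`ℓ(R/I^{n+1}) = ∑ᵢ (-1)^i eᵢ C(n+d-i, d-i)` for all large `n`. -/
def IsHilbertCoeffs {R : Type u} [CommRing R] (I : Ideal R) (e : ℕ → ℤ) : Prop :=
  ∃ d : ℕ, ringKrullDim R = (d : WithBot ℕ∞) ∧ (∀ i, d < i → e i = 0) ∧
    ∀ᶠ n : ℕ in Filter.atTop,
      lengthInt R (R ⧸ I ^ (n + 1)) =
        ∑ i ∈ Finset.range (d + 1), (-1) ^ i * e i * ((n + d - i).choose (d - i) : ℤ)

open Classical in
/-- The Hilbert coefficient `eᵢ(I)`. For an ideal `I` primary to the maximal ideal of a Noetherian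
local ring, a sequence as in `IsHilbertCoeffs` exists and is unique; where none exists, the value
is `0`. -/
def hilbertCoeff {R : Type u} [CommRing R] (I : Ideal R) (i : ℕ) : ℤ :=
  if h : ∃ e : ℕ → ℤ, IsHilbertCoeffs I e then h.choose i else 0

/-- A local ring is Buchsbaum if `ℓ(R/Q) - e₀(Q)` is the same for all parameter ideals `Q`. -/
def IsBuchsbaum (R : Type u) [CommRing R] [IsLocalRing R] : Prop :=
  ∃ c : ℤ, ∀ Q : Ideal R, IsParameterIdeal Q → lengthInt R (R ⧸ Q) - hilbertCoeff Q 0 = c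

/-- The depth of a local ring: the supremum of the lengths of the regular sequences contained in
the maximal ideal. -/
def localDepth (R : Type u) [CommRing R] [IsLocalRing R] : ℕ∞ :=
  ⨆ rs ∈ {rs : List R | (∀ r ∈ rs, r ∈ IsLocalRing.maximalIdeal R) ∧
    RingTheory.Sequence.IsRegular R rs}, (rs.length : ℕ∞)

/-- Serre's condition `(S_k)`: `depth R_p ≥ min (k, dim R_p)` for every prime `p`. -/
def SatisfiesSerreS (R : Type u) [CommRing R] (k : ℕ) : Prop :=
  ∀ (p : Ideal R) [p.IsPrime],
    min (k : WithBot ℕ∞) (ringKrullDim (Localization.AtPrime p)) ≤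
      (localDepth (Localization.AtPrime p) : WithBot ℕ∞)

/-- A local ring is Cohen–Macaulay if its depth equals its dimension. -/
def IsCohenMacaulayLocal (R : Type u) [CommRing R] [IsLocalRing R] : Prop :=
  (localDepth R : WithBot ℕ∞) = ringKrullDim R

theorem limitClosure_step {R : Type u} [CommRing R] {d : ℕ} (x : Fin d → R) {a : R} {n : ℕ}
    (h : a * (∏ i, x i) ^ n ∈ Ideal.span (Set.range fun i => x i ^ (n + 1))) :
    a * (∏ i, x i) ^ (n + 1) ∈ Ideal.span (Set.range fun i => x i ^ (n + 1 + 1)) := by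
  rw [pow_succ, ← mul_assoc]
  refine Submodule.span_induction
    (p := fun b _ => b * ∏ i, x i ∈ Ideal.span (Set.range fun i => x i ^ (n + 1 + 1)))
    ?_ ?_ ?_ ?_ h
  · rintro _ ⟨i, rfl⟩
    obtain ⟨c, hc⟩ := Finset.dvd_prod_of_mem x (Finset.mem_univ i)
    rw [hc, show x i ^ (n + 1) * (x i * c) = c * x i ^ (n + 1 + 1) by ring]
    exact Ideal.mul_mem_left _ _ (Ideal.subset_span ⟨i, rfl⟩)
  · simp
  · intro b c _ _ hb hc
    rw [add_mul]
    exact add_mem hb hc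
  · intro r b _ hb
    rw [smul_eq_mul, mul_assoc]
    exact Ideal.mul_mem_left _ _ hb

theorem limitClosure_mono {R : Type u} [CommRing R] {d : ℕ} (x : Fin d → R) {a : R} {m n : ℕ}
    (hmn : m ≤ n) (h : a * (∏ i, x i) ^ m ∈ Ideal.span (Set.range fun i => x i ^ (m + 1))) :
    a * (∏ i, x i) ^ n ∈ Ideal.span (Set.range fun i => x i ^ (n + 1)) := by
  induction n, hmn using Nat.le_induction with
  | base => exact h
  | succ n _ ih => exact limitClosure_step x ih

/-- The limit closure of `Q = (x₁, …, x_d)`: the union over `n ≥ 0` of the ideals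
`(x₁^{n+1}, …, x_d^{n+1}) : (x₁ ⋯ x_d)^n`. -/
def limitClosure {R : Type u} [CommRing R] {d : ℕ} (x : Fin d → R) : Ideal R where
  carrier := {a | ∃ n : ℕ, a * (∏ i, x i) ^ n ∈ Ideal.span (Set.range fun i => x i ^ (n + 1))}
  zero_mem' := ⟨0, by simp⟩
  add_mem' := by
    rintro a b ⟨m, hm⟩ ⟨n, hn⟩
    refine ⟨max m n, ?_⟩
    rw [add_mul]
    exact add_mem (limitClosure_mono x (le_max_left m n) hm)
      (limitClosure_mono x (le_max_right m n) hn)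
  smul_mem' := by
    rintro c a ⟨n, hn⟩
    refine ⟨n, ?_⟩
    rw [smul_eq_mul, mul_assoc]
    exact Ideal.mul_mem_left _ _ hn

end

/-! Let `Q = (x_0, …, x_{d-1})` with `d ≥ 2` and let `C_i = ((x_j, j ≠ i) : x_i) + Q` be `colonSup x
i`. Each `C_i` lies in the limit closure, so the inequality follows from `ℓ(R/(C_0 + C_1)) ≤ e_0 +
e_1`. Two estimates give this bound.

The first holds for any parameters with `ℓ(R/C_0) = e_0`. Filter the powers of `Q` by monomials,
ordered lexicographically within each degree. Then `ℓ(R/Q^{n+1})` is the sum of `ℓ(R/L_α)` over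
exponents of degree at most `n`. Here `L_α` contains `Q`, and it contains `(x_j, j > i) : x_i` as
soon as `α_i > 0`. With `b = ℓ(R/(((x_j, j > 1) : x_1) + Q))`, the terms with `α_0 > 0` are at most
`e_0`, those with `α_1 > 0` are at most `b`, and the rest affect only lower order. Comparing the
second coefficients yields `e_1 ≥ e_0 - b` (`le_hilbertCoeff_one`).

The second uses the Buchsbaum property. Constancy of `ℓ(R/Q) - e_0(Q)` forces `e_0` to be
multiplicative under raising one parameter to a power (`paramMult_update_pow`). This gives `ℓ(R/C_i)
= e_0` and, by Nakayama, `Q_J : x_i^2 = Q_J : x_i`, where `Q_J` is generated by the parameters with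
index in `J` and `i ∉ J`. It follows that `(Q_J : x_i) ∩ Q = Q_J` (`mem_span_of_mul_param_mem`).
Hence `C_0 ∩ C_1 ⊆ ((x_j, j > 1) : x_1) + Q` (`colonSup_inf_le`), so `b ≤ ℓ(R/(C_0 ∩ C_1)) = 2 e_0 -
ℓ(R/(C_0 + C_1))`, and the two estimates combine.

If equality holds, permuting the parameters gives `Q^lim = C_i + C_j` for all `i ≠ j`. Serre's
condition makes each parameter regular modulo at most one other. An induction on `|J|` then shows
that `x_i` is regular modulo `Q_J`: an element of `Q_J : x_i` lies in `Q^lim`, so its product with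
all `x_j`, `j ∈ J`, lies in the ideal where these parameters are squared. The intersection property
for that system and the induction hypothesis bring the element back to `Q_J`.

In dimensions zero and one the expression is computed directly and vanishes. -/

/-- The length of `R ⧸ I` as an integer. -/
noncomputable abbrev colength {R : Type*} [CommRing R] (I : Ideal R) : ℤ := lengthInt R (R ⧸ I)

/-! ### Lengths of quotients by ideals and their additivity -/

section Length

variable {R : Type*} [CommRing R]

theorem length_quotient_ne_top_of_le {I J : Ideal R} (hI : Module.length R (R ⧸ I) ≠ ⊤)
    (hIJ : I ≤ J) : Module.length R (R ⧸ J) ≠ ⊤ :=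
  ne_top_of_le_ne_top hI <| Module.length_le_of_surjective (Submodule.factor hIJ)
    (Submodule.factor_surjective hIJ)

theorem colength_top : colength (⊤ : Ideal R) = 0 := by
  have : Subsingleton (R ⧸ (⊤ : Ideal R)) := Ideal.Quotient.subsingleton_iff.mpr rfl
  simp [colength, lengthInt, Module.length_eq_zero]

theorem colength_mono {I J : Ideal R} (hI : Module.length R (R ⧸ I) ≠ ⊤) (hIJ : I ≤ J) :
    colength J ≤ colength I :=
  Int.ofNat_le.mpr <| ENat.toNat_le_toNat (Module.length_le_of_surjective (Submodule.factor hIJ)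
    (Submodule.factor_surjective hIJ)) hI

theorem eq_of_colength_le {I J : Ideal R} (hI : Module.length R (R ⧸ I) ≠ ⊤) (hIJ : I ≤ J)
    (h : colength I ≤ colength J) : I = J := by
  by_contra hne
  have hlt : I < J := lt_of_le_of_ne hIJ hne
  have h1 : Module.length R (R ⧸ J) < Module.length R (R ⧸ I) := by
    have hJ := length_quotient_ne_top_of_le hI hIJ
    rw [Module.length_quotient] at hJ ⊢
    rw [Module.length_quotient]
    exact Order.coheight_strictAnti hlt (lt_top_iff_ne_top.mpr hJ)
  have h2 : (Module.length R (R ⧸ I)).toNat ≤ (Module.length R (R ⧸ J)).toNat := Int.ofNat_le.mp h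
  rw [← ENat.natCast_toNat hI, ← ENat.natCast_toNat (length_quotient_ne_top_of_le hI hIJ)] at h1
  exact absurd (Nat.cast_lt.mp h1) (not_lt.mpr h2)

theorem length_quotient_eq_add_comap {M P : Type*} [AddCommGroup M] [Module R M] [AddCommGroup P]
    [Module R P] (N : Submodule R M) (f : P →ₗ[R] M) :
    Module.length R (M ⧸ N) =
      Module.length R (P ⧸ N.comap f) + Module.length R (M ⧸ (N ⊔ LinearMap.range f)) := by
  refine Module.length_eq_add_of_exact ((N.comap f).mapQ N f le_rfl)
    (Submodule.factor le_sup_left) ?_ (Submodule.factor_surjective _) ?_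
  · rw [injective_iff_map_eq_zero]
    intro y hy
    obtain ⟨y, rfl⟩ := Submodule.mkQ_surjective _ y
    simpa [Submodule.Quotient.mk_eq_zero] using hy
  · intro y
    obtain ⟨y, rfl⟩ := Submodule.mkQ_surjective _ y
    rw [Submodule.factor, Submodule.mkQ_apply, Submodule.mapQ_apply, LinearMap.id_apply,
      Submodule.Quotient.mk_eq_zero]
    constructor
    · intro hy
      obtain ⟨i, hi, _, ⟨p, rfl⟩, rfl⟩ := Submodule.mem_sup.mp hy
      refine ⟨Submodule.Quotient.mk p, ?_⟩
      rw [Submodule.mapQ_apply, Submodule.Quotient.eq]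
      simpa using hi
    · rintro ⟨p, hp⟩
      obtain ⟨p, rfl⟩ := Submodule.mkQ_surjective _ p
      rw [Submodule.mkQ_apply, Submodule.mapQ_apply, Submodule.Quotient.eq] at hp
      rw [← sub_sub_cancel (f p) y]
      exact Submodule.sub_mem _ (Submodule.mem_sup_right ⟨p, rfl⟩) (Submodule.mem_sup_left hp)

theorem length_quotient_eq_add_colon (N : Ideal R) (m : R) :
    Module.length R (R ⧸ N) =
      Module.length R (R ⧸ N.colon {m}) + Module.length R (R ⧸ (N ⊔ Ideal.span {m})) := by
  have h1 : N.colon {m} = Submodule.comap (LinearMap.toSpanSingleton R R m) N := by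
    ext a
    rw [Submodule.mem_colon_singleton, Submodule.mem_comap, LinearMap.toSpanSingleton_apply]
  have h2 : Ideal.span {m} = LinearMap.range (LinearMap.toSpanSingleton R R m) :=
    (LinearMap.range_toSpanSingleton (R := R) m).symm
  rw [h1, h2]
  exact length_quotient_eq_add_comap (M := R) (P := R) N _

theorem colength_eq_add_colon {N : Ideal R} (hN : Module.length R (R ⧸ N) ≠ ⊤) (m : R) :
    colength N = colength (N ⊔ Ideal.span {m}) + colength (N.colon {m}) := by
  have h := length_quotient_eq_add_colon N m
  have h1 : Module.length R (R ⧸ N.colon {m}) ≠ ⊤ :=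
    length_quotient_ne_top_of_le hN fun a ha => by
      simpa [Submodule.mem_colon_singleton] using N.mul_mem_right m ha
  have h2 := length_quotient_ne_top_of_le hN (le_sup_left : N ≤ N ⊔ Ideal.span {m})
  rw [colength, lengthInt, h, ENat.toNat_add h1 h2, add_comm]
  push_cast
  rfl

theorem length_quotient_inf_add_length_quotient_sup {M : Type*} [AddCommGroup M] [Module R M]
    (I J : Submodule R M) :
    Module.length R (M ⧸ I) + Module.length R (M ⧸ J) =
      Module.length R (M ⧸ (I ⊓ J)) + Module.length R (M ⧸ (I ⊔ J)) := by
  have h1 := length_quotient_eq_add_comap (I ⊓ J) I.subtype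
  have h2 := length_quotient_eq_add_comap J I.subtype
  have h3 : (I ⊓ J).comap I.subtype = J.comap I.subtype := by ext; simp
  rw [Submodule.range_subtype, sup_eq_right.mpr inf_le_left, h3] at h1
  rw [Submodule.range_subtype] at h2
  rw [h1, h2, sup_comm]
  ring

theorem colength_inf_add_colength_sup {I J : Ideal R} (h : Module.length R (R ⧸ (I ⊓ J)) ≠ ⊤) :
    colength (I ⊓ J) + colength (I ⊔ J) = colength I + colength J := by
  have key : Module.length R (R ⧸ I) + Module.length R (R ⧸ J) =
      Module.length R (R ⧸ (I ⊓ J)) + Module.length R (R ⧸ (I ⊔ J)) :=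
    length_quotient_inf_add_length_quotient_sup I J
  have hI := length_quotient_ne_top_of_le h (inf_le_left : I ⊓ J ≤ I)
  have hJ := length_quotient_ne_top_of_le h (inf_le_right : I ⊓ J ≤ J)
  have hs := length_quotient_ne_top_of_le hI (le_sup_left : I ≤ I ⊔ J)
  have := congrArg ENat.toNat key
  rw [ENat.toNat_add hI hJ, ENat.toNat_add h hs] at this
  simp only [colength, lengthInt]
  exact_mod_cast this.symm

/-- The length of the filtration of `J ⧸ J₀` by multiples of an ordered set of elements. -/
theorem colength_eq_sum_colon {ι : Type*} [LinearOrder ι] (m : ι → R) {J : Ideal R}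
    (hJ : Module.length R (R ⧸ J) ≠ ⊤) (s : Finset ι) :
    colength J = colength (J ⊔ Ideal.span (m '' s)) +
      ∑ i ∈ s, colength ((J ⊔ Ideal.span (m '' {j | j ∈ s ∧ j < i})).colon {m i}) := by
  induction s using Finset.induction_on_max with
  | empty => simp
  | insert a s ha ih =>
    have hnot : a ∉ s := fun h => lt_irrefl _ (ha a h)
    rw [Finset.sum_insert hnot, ih,
      colength_eq_add_colon (length_quotient_ne_top_of_le hJ le_sup_left) (m a)]
    have h1 : {j | j ∈ insert a s ∧ j < a} = (s : Set ι) := by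
      ext j
      simp only [Finset.mem_insert, Set.mem_ofPred_eq, Finset.mem_coe]
      constructor
      · rintro ⟨rfl | h, h'⟩
        · exact absurd h' (lt_irrefl _)
        · exact h
      · exact fun h => ⟨Or.inr h, ha j h⟩
    have h2 : ∀ i ∈ s, {j | j ∈ insert a s ∧ j < i} = {j | j ∈ s ∧ j < i} := by
      intro i hi
      ext j
      simp only [Finset.mem_insert, Set.mem_ofPred_eq]
      constructor
      · rintro ⟨rfl | h, h'⟩
        · exact absurd h' (not_lt.mpr (ha i hi).le)
        · exact ⟨h, h'⟩
      · exact fun h => ⟨Or.inr h.1, h.2⟩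
    rw [h1, Finset.sum_congr rfl fun i hi => by rw [← h2 i hi], Finset.coe_insert, Set.image_insert_eq,
      Ideal.span_insert, add_assoc, sup_assoc, sup_comm (Ideal.span (m '' s))]

theorem length_quotient_ne_top_of_pow_le [IsLocalRing R] [IsNoetherianRing R] {I : Ideal R} {n : ℕ}
    (h : IsLocalRing.maximalIdeal R ^ n ≤ I) : Module.length R (R ⧸ I) ≠ ⊤ := by
  by_cases hI : I = ⊤
  · have : Subsingleton (R ⧸ I) := Ideal.Quotient.subsingleton_iff.mpr hI
    simp [Module.length_eq_zero]
  have hart : IsArtinianRing (R ⧸ I) := by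
    apply IsLocalRing.quotient_artinian_of_mem_minimalPrimes_of_isLocalRing
    refine ⟨⟨inferInstance, IsLocalRing.le_maximalIdeal hI⟩, fun p hp _ => ?_⟩
    have := hp.1
    exact hp.1.le_of_pow_le (h.trans hp.2)
  have : IsArtinian R (R ⧸ I) := 
    isArtinian_of_surjective_algebraMap (R := R ⧸ I) Ideal.Quotient.mk_surjective
  exact Module.length_ne_top

end Length

/-! ### Sums over lattice simplices and eventually polynomial functions -/

section Combinatorics

open Filter Finset

theorem sum_antidiagonalTuple_succ (d : ℕ) (g : (Fin (d + 1) → ℕ) → ℤ) (m : ℕ) :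
    ∑ α ∈ Nat.antidiagonalTuple (d + 1) m, g α =
      ∑ k ∈ range (m + 1), ∑ β ∈ Nat.antidiagonalTuple d (m - k), g (Fin.cons k β) := by
  rw [Finset.sum_sigma']
  refine Finset.sum_bij' (fun α _ => ⟨α 0, Fin.tail α⟩) (fun p _ => Fin.cons p.1 p.2) ?_ ?_ ?_ ?_ ?_
  · intro α hα
    rw [Nat.mem_antidiagonalTuple, Fin.sum_univ_succ] at hα
    simp only [mem_sigma, mem_range, Nat.mem_antidiagonalTuple, Fin.tail]
    omega
  · rintro ⟨k, β⟩ h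
    simp only [mem_sigma, mem_range, Nat.mem_antidiagonalTuple] at h
    simp only [Nat.mem_antidiagonalTuple, Fin.sum_univ_succ, Fin.cons_zero, Fin.cons_succ]
    omega
  · intro α _
    exact Fin.cons_self_tail α
  · rintro ⟨k, β⟩ _
    simp
  · intro α _
    rw [Fin.cons_self_tail]

/-- The sum of `g α` over all exponents `α` of total degree at most `n`. -/
def simplexSum (d : ℕ) (g : (Fin d → ℕ) → ℤ) (n : ℕ) : ℤ :=
  ∑ m ∈ range (n + 1), ∑ α ∈ Nat.antidiagonalTuple d m, g α

theorem simplexSum_zero (g : (Fin 0 → ℕ) → ℤ) (n : ℕ) : simplexSum 0 g n = g ![] := by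
  rw [simplexSum, sum_range_succ']
  simp

theorem simplexSum_succ (d : ℕ) (g : (Fin (d + 1) → ℕ) → ℤ) (n : ℕ) :
    simplexSum (d + 1) g n =
      ∑ k ∈ range (n + 1), simplexSum d (fun β => g (Fin.cons k β)) (n - k) := by
  simp only [simplexSum, sum_antidiagonalTuple_succ]
  rw [sum_range_diag_flip (n + 1)
    (fun k j => ∑ β ∈ Nat.antidiagonalTuple d j, g (Fin.cons k β))]
  refine sum_congr rfl fun k hk => ?_
  rw [Nat.sub_add_comm (Nat.lt_succ_iff.mp (mem_range.mp hk))]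

theorem simplexSum_mono {d : ℕ} {g h : (Fin d → ℕ) → ℤ} (hgh : ∀ α, g α ≤ h α) (n : ℕ) :
    simplexSum d g n ≤ simplexSum d h n :=
  sum_le_sum fun _ _ => sum_le_sum fun _ _ => hgh _

theorem sum_range_choose_add (d n : ℕ) :
    ∑ k ∈ range (n + 1), ((k + d).choose d : ℤ) = ((n + (d + 1)).choose (d + 1) : ℤ) := by
  induction n with
  | zero => simp
  | succ n ih =>
    rw [sum_range_succ, ih, show n + 1 + (d + 1) = n + 1 + d + 1 by ring, Nat.choose_succ_succ,
      show n + (d + 1) = n + 1 + d by ring]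
    push_cast
    ring

theorem simplexSum_const (d : ℕ) (a : ℤ) (n : ℕ) :
    simplexSum d (fun _ => a) n = a * ((n + d).choose d : ℤ) := by
  induction d generalizing n with
  | zero => simp [simplexSum_zero]
  | succ d ih =>
    rw [simplexSum_succ]
    simp only [ih]
    rw [← sum_range_choose_add, mul_sum,
      ← sum_range_reflect (fun k => a * ((k + d).choose d : ℤ)) (n + 1)]
    refine sum_congr rfl fun k hk => ?_
    rw [show n + 1 - 1 - k = n - k by omega]

/-- `f` is eventually a polynomial function of degree at most `d`: its `d`-th difference is
eventually constant. -/
def EventuallyPoly : ℕ → (ℕ → ℤ) → Prop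
  | 0, f => ∃ c, ∀ᶠ n in atTop, f n = c
  | d + 1, f => EventuallyPoly d fun n => f (n + 1) - f n

namespace EventuallyPoly

theorem congr {d : ℕ} {f g : ℕ → ℤ} (hf : EventuallyPoly d f) (h : ∀ᶠ n in atTop, f n = g n) :
    EventuallyPoly d g := by
  induction d generalizing f g with
  | zero =>
    obtain ⟨c, hc⟩ := hf
    exact ⟨c, by filter_upwards [hc, h] with n h1 h2; rw [← h2, h1]⟩
  | succ d ih =>
    refine ih hf ?_
    filter_upwards [h, (tendsto_add_atTop_nat 1).eventually h] with n h1 h2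
    rw [h1, h2]

theorem add {d : ℕ} {f g : ℕ → ℤ} (hf : EventuallyPoly d f) (hg : EventuallyPoly d g) :
    EventuallyPoly d fun n => f n + g n := by
  induction d generalizing f g with
  | zero =>
    obtain ⟨c, hc⟩ := hf
    obtain ⟨c', hc'⟩ := hg
    exact ⟨c + c', by filter_upwards [hc, hc'] with n h1 h2; rw [h1, h2]⟩
  | succ d ih =>
    refine (ih hf hg).congr (Eventually.of_forall fun n => ?_)
    ring

theorem succ {d : ℕ} {f : ℕ → ℤ} (hf : EventuallyPoly d f) : EventuallyPoly (d + 1) f := by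
  induction d generalizing f with
  | zero =>
    obtain ⟨c, hc⟩ := hf
    refine ⟨0, ?_⟩
    filter_upwards [hc, (tendsto_add_atTop_nat 1).eventually hc] with n h1 h2
    rw [h1, h2, sub_self]
  | succ d ih => exact ih hf

theorem comp_succ {d : ℕ} {f : ℕ → ℤ} (hf : EventuallyPoly d f) :
    EventuallyPoly d fun n => f (n + 1) := by
  induction d generalizing f with
  | zero =>
    obtain ⟨c, hc⟩ := hf
    exact ⟨c, (tendsto_add_atTop_nat 1).eventually hc⟩
  | succ d ih => exact ih hf

theorem of_comp_succ {d : ℕ} {f : ℕ → ℤ} (hf : EventuallyPoly d fun n => f (n + 1)) :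
    EventuallyPoly d f := by
  induction d generalizing f with
  | zero =>
    obtain ⟨c, hc⟩ := hf
    obtain ⟨N, hN⟩ := eventually_atTop.mp hc
    refine ⟨c, eventually_atTop.mpr ⟨N + 1, fun n hn => ?_⟩⟩
    have : f (n - 1 + 1) = c := hN (n - 1) (by omega)
    rwa [Nat.sub_add_cancel (by omega)] at this
  | succ d ih => exact ih hf

/-- If all slices coincide, the sum is a partial sum of one function, whose difference is that
function shifted. Finitely many exceptional slices are peeled off one at a time, and each adds only
a term of lower degree. -/
theorem convolution {d : ℕ} {s : ℕ → ℕ → ℤ} (hs : ∀ k, EventuallyPoly d (s k)) {K : ℕ}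
    (hK : ∀ k, K ≤ k → s k = s K) :
    EventuallyPoly (d + 1) fun n => ∑ k ∈ range (n + 1), s k (n - k) := by
  induction K generalizing s with
  | zero =>
    refine ((hs 0).comp_succ).congr (Eventually.of_forall fun n => ?_)
    have h : ∀ n, ∑ k ∈ range (n + 1), s k (n - k) = ∑ j ∈ range (n + 1), s 0 j := by
      intro n
      rw [← sum_range_reflect (s 0)]
      refine sum_congr rfl fun k _ => ?_
      rw [hK k (Nat.zero_le k), show n + 1 - 1 - k = n - k by omega]
    beta_reduce
    rw [h, h, sum_range_succ _ (n + 1), add_sub_cancel_left]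
  | succ K ih =>
    apply of_comp_succ
    have h1 := ih (s := fun k => s (k + 1)) (fun k => hs (k + 1)) fun k hk => hK (k + 1) (by omega)
    refine (h1.add (hs 0).comp_succ.succ).congr (Eventually.of_forall fun n => ?_)
    rw [sum_range_succ' _ (n + 1)]
    simp

theorem exists_coeffs {d : ℕ} {f : ℕ → ℤ} (hf : EventuallyPoly d f) :
    ∃ a : ℕ → ℤ, ∀ᶠ n in atTop, f n = ∑ j ∈ range (d + 1), a j * ((n + j).choose j : ℤ) := by
  induction d generalizing f with
  | zero =>
    obtain ⟨c, hc⟩ := hf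
    exact ⟨fun _ => c, by filter_upwards [hc] with n h; simp [h]⟩
  | succ d ih =>
    obtain ⟨a, ha⟩ := ih hf
    obtain ⟨N, hN⟩ := eventually_atTop.mp ha
    -- By Pascal's rule the difference of `C(n+j+1, j+1)` is `C(n+j+1, j)`. Subtracting `C(n+j, j)`
    -- corrects the shift, so `F` is an exact antidifference.
    let F : ℕ → ℤ := fun n =>
      ∑ j ∈ range (d + 1), a j * (((n + (j + 1)).choose (j + 1) : ℤ) - ((n + j).choose j : ℤ))
    have hF : ∀ n, F (n + 1) - F n = ∑ j ∈ range (d + 1), a j * ((n + j).choose j : ℤ) := by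
      intro n
      rw [← sum_sub_distrib]
      refine sum_congr rfl fun j _ => ?_
      rw [show n + 1 + (j + 1) = n + j + 1 + 1 by ring, 
        Nat.choose_succ_succ' (n + j + 1), show n + (j + 1) = n + j + 1 by ring,
        show n + 1 + j = n + j + 1 by ring]
      push_cast
      ring
    have hconst : ∀ n, N ≤ n → f n = F n + (f N - F N) := by
      intro n hn
      induction n, hn using Nat.le_induction with
      | base => ring
      | succ n hn ih' => linear_combination hN n hn - hF n + ih'
    let b : ℕ → ℤ := fun j =>
      (if j = 0 then f N - F N else a (j - 1)) - (if j ≤ d then a j else 0)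
    refine ⟨b, eventually_atTop.mpr ⟨N, fun n hn => ?_⟩⟩
    rw [hconst n hn]
    simp only [b, sub_mul, sum_sub_distrib]
    rw [sum_range_succ' _ (d + 1), sum_range_succ _ (d + 1)]
    simp only [F, mul_sub, sum_sub_distrib]
    have h1 : ∑ j ∈ range (d + 1), (if j ≤ d then a j else 0) * ((n + j).choose j : ℤ) =
        ∑ j ∈ range (d + 1), a j * ((n + j).choose j : ℤ) :=
      sum_congr rfl fun j hj => by rw [if_pos (by rw [mem_range] at hj; omega)]
    rw [h1]
    simp
    ring

end EventuallyPoly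

/-- Dickson's lemma: each sublevel set of `g` is an upper set with finitely many minimal elements,
and only levels up to `g 0` matter. Any bound on the first coordinates of these minimal elements
serves as `K`. -/
theorem exists_stable_of_antitone {d : ℕ} {g : (Fin (d + 1) → ℕ) → ℕ} (hg : Antitone g) :
    ∃ K, ∀ k, K ≤ k → ∀ β : Fin d → ℕ, g (Fin.cons k β) = g (Fin.cons K β) := by
  have hfin : ∀ m, {α | Minimal (fun β => g β ≤ m) α}.Finite := fun m =>
    WellQuasiOrderedLE.finite_of_isAntichain (setOfPred_minimal_antichain _)
  let T : Set (Fin (d + 1) → ℕ) := ⋃ m ∈ Set.Iic (g 0), {α | Minimal (fun β => g β ≤ m) α}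
  have hT : T.Finite := (Set.finite_Iic (g 0)).biUnion fun m _ => hfin m
  obtain ⟨K, hK⟩ := (hT.image fun α => α 0).bddAbove
  refine ⟨K, fun k hk β => le_antisymm (hg ?_) ?_⟩
  · exact Fin.cons_le_cons.mpr ⟨hk, le_rfl⟩
  · obtain ⟨α, hα, hmin⟩ := (Set.isPWO_of_wellQuasiOrderedLE _).exists_le_minimal
      (show Fin.cons k β ∈ {α | g α ≤ g (Fin.cons k β)} from le_refl (g (Fin.cons k β)))
    have h0 : α 0 ≤ K := hK ⟨α, Set.mem_biUnion (hg fun i => Nat.zero_le _) hmin, rfl⟩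
    refine le_trans (hg (a := α) fun i => ?_) hmin.prop
    refine Fin.cases ?_ (fun j => ?_) i
    · simpa using h0
    · simpa using hα j.succ

theorem eventuallyPoly_simplexSum {d : ℕ} {g : (Fin d → ℕ) → ℕ} (hg : Antitone g) :
    EventuallyPoly d (simplexSum d fun α => (g α : ℤ)) := by
  induction d with
  | zero => exact ⟨g ![], Eventually.of_forall fun n => simplexSum_zero _ n⟩
  | succ d ih =>
    obtain ⟨K, hK⟩ := exists_stable_of_antitone hg
    have hs : ∀ k, EventuallyPoly d (simplexSum d fun β => (g (Fin.cons k β) : ℤ)) := fun k =>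
      ih (g := fun β => g (Fin.cons k β)) fun β γ h => hg (Fin.cons_le_cons.mpr ⟨le_rfl, h⟩)
    have h := EventuallyPoly.convolution hs (K := K) fun k hk => by simp only [hK k hk]
    have hsucc : (simplexSum (d + 1) fun α => (g α : ℤ)) = fun n =>
        ∑ k ∈ range (n + 1), simplexSum d (fun β => (g (Fin.cons k β) : ℤ)) (n - k) :=
      funext fun n => simplexSum_succ d _ n
    rw [hsucc]
    exact h

/-- An upper bound for a sum over a simplex in terms of bounds depending on the first two
exponents. -/
theorem simplexSum_le {D : ℕ} {g : (Fin (D + 2) → ℕ) → ℤ} {a b e : ℤ} (ha : ∀ α, g α ≤ a)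
    (hb : ∀ α, 0 < α 1 → g α ≤ b) (he : ∀ α, 0 < α 0 → g α ≤ e) (n : ℕ) :
    simplexSum (D + 2) g (n + 1) ≤ e * ((n + (D + 2)).choose (D + 2) : ℤ) +
      b * ((n + (D + 1)).choose (D + 1) : ℤ) + a * ((n + 1 + D).choose D : ℤ) := by
  -- Exponents with positive first entry form a simplex of size one smaller; the others form a face
  -- of one dimension less. This is used twice, for the first two coordinates.
  have key : ∀ (d : ℕ) (h : (Fin (d + 1) → ℕ) → ℤ) (c : ℤ), (∀ α, 0 < α 0 → h α ≤ c) →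
      simplexSum (d + 1) h (n + 1) ≤ c * ((n + (d + 1)).choose (d + 1) : ℤ) +
        simplexSum d (fun β => h (Fin.cons 0 β)) (n + 1) := by
    intro d h c hc
    rw [simplexSum_succ, sum_range_succ', ← simplexSum_const, simplexSum_succ]
    refine add_le_add (sum_le_sum fun k _ => ?_) le_rfl
    rw [Nat.add_sub_add_right]
    exact simplexSum_mono (fun β => hc _ (by simp)) _
  have h1 := key (D + 1) g e he
  have h2 := key D (fun β => g (Fin.cons 0 β)) b fun α hα => hb _ (by simpa using hα)
  have h3 := simplexSum_mono (d := D) (g := fun β => g (Fin.cons 0 (Fin.cons 0 β)))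
    (h := fun _ => a) (fun β => ha _) (n + 1)
  rw [simplexSum_const] at h3
  linarith

end Combinatorics

/-! ### Monomial filtration of the powers of an ideal -/

section Monomials

variable {R : Type*} [CommRing R] {d : ℕ}

/-- The monomial with exponent `α` in the elements `x`. -/
def monom (x : Fin d → R) (α : Fin d → ℕ) : R := ∏ i, x i ^ α i

theorem monom_add (x : Fin d → R) (α β : Fin d → ℕ) :
    monom x (α + β) = monom x α * monom x β := by
  simp [monom, pow_add, Finset.prod_mul_distrib]

theorem monom_single (x : Fin d → R) (i : Fin d) : monom x (Pi.single i 1) = x i := by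
  rw [monom, Finset.prod_eq_single i]
  · simp
  · intro j _ hj
    simp [hj]
  · simp

theorem span_pow_eq_span_monom (x : Fin d → R) (k : ℕ) :
    Ideal.span (Set.range x) ^ k = Ideal.span (monom x '' {α | ∑ i, α i = k}) := by
  induction k with
  | zero =>
    rw [pow_zero, eq_comm, Ideal.one_eq_top, Ideal.eq_top_iff_one]
    exact Ideal.subset_span ⟨0, by simp, by simp [monom]⟩
  | succ k ih =>
    rw [pow_succ, ih, Ideal.span_mul_span']
    refine le_antisymm (Ideal.span_le.mpr ?_) (Ideal.span_le.mpr ?_)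
    · rintro _ ⟨_, ⟨α, hα, rfl⟩, _, ⟨i, rfl⟩, rfl⟩
      refine Ideal.subset_span ⟨α + Pi.single i 1, ?_, ?_⟩
      · have : ∑ i, α i = k := hα
        simp [Finset.sum_add_distrib, this]
      · rw [monom_add, monom_single]
    · rintro _ ⟨α, hα, rfl⟩
      have hα' : ∑ i, α i = k + 1 := hα
      obtain ⟨i, hi⟩ : ∃ i, α i ≠ 0 := by
        by_contra! h
        simp [h] at hα'
      have hle : Pi.single i 1 ≤ α := by
        intro j
        by_cases hj : j = i
        · subst hj; simpa using Nat.one_le_iff_ne_zero.mpr hi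
        · simp [hj]
      obtain ⟨β, rfl⟩ := exists_add_of_le hle
      refine Ideal.subset_span ⟨monom x β, ⟨β, ?_, rfl⟩, x i, ⟨i, rfl⟩, ?_⟩
      · simp only [Pi.add_apply, Finset.sum_add_distrib] at hα'
        simp only [Finset.sum_pi_single', Finset.mem_univ, if_true] at hα'
        change ∑ i, β i = k
        omega
      · rw [monom_add, monom_single]
        ring

theorem monom_mem_span_pow (x : Fin d → R) (α : Fin d → ℕ) :
    monom x α ∈ Ideal.span (Set.range x) ^ ∑ i, α i := by
  rw [span_pow_eq_span_monom]
  exact Ideal.subset_span ⟨α, rfl, rfl⟩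

/-- The ideal generated by the monomials that precede `α`: those of larger degree, and those of the
same degree that are lexicographically smaller. -/
def precedingIdeal (x : Fin d → R) (α : Fin d → ℕ) : Ideal R :=
  Ideal.span (Set.range x) ^ (∑ i, α i + 1) ⊔
    Ideal.span (monom x '' {β | ∑ i, β i = ∑ i, α i ∧ toLex β < toLex α})

/-- The coefficients of the monomial with exponent `α` that can be reduced to preceding ones. -/
def leadIdeal (x : Fin d → R) (α : Fin d → ℕ) : Ideal R := (precedingIdeal x α).colon {monom x α}

theorem mem_leadIdeal {x : Fin d → R} {α : Fin d → ℕ} {a : R} :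
    a ∈ leadIdeal x α ↔ a * monom x α ∈ precedingIdeal x α := by
  rw [leadIdeal, Submodule.mem_colon_singleton, smul_eq_mul]

/-- The order on monomials is compatible with multiplication, so multiplying by a monomial carries
preceding monomials to preceding ones. -/
theorem leadIdeal_mono (x : Fin d → R) : Monotone (leadIdeal x) := by
  intro α β hαβ a ha
  obtain ⟨γ, rfl⟩ := exists_add_of_le hαβ
  rw [mem_leadIdeal] at ha ⊢
  rw [monom_add, ← mul_assoc]
  have hle : precedingIdeal x α * Ideal.span {monom x γ} ≤ precedingIdeal x (α + γ) := by
    rw [precedingIdeal, Ideal.sup_mul]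
    refine sup_le ?_ ?_
    · refine le_sup_of_le_left ?_
      rw [show ∑ i, (α + γ) i + 1 = (∑ i, α i + 1) + ∑ i, γ i by
        simp only [Pi.add_apply, Finset.sum_add_distrib]; ring, pow_add _ (∑ i, α i + 1)]
      exact Ideal.mul_mono_right ((Ideal.span_singleton_le_iff_mem _).mpr (monom_mem_span_pow x γ))
    · refine le_sup_of_le_right ?_
      rw [Ideal.span_mul_span', Ideal.span_le]
      rintro _ ⟨_, ⟨β, ⟨hβ, hlt⟩, rfl⟩, _, rfl, rfl⟩
      refine Ideal.subset_span ⟨β + γ, ⟨?_, ?_⟩, monom_add x β γ⟩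
      · simp only [Pi.add_apply, Finset.sum_add_distrib, hβ]
      · rw [toLex_add, toLex_add]
        exact add_lt_add_left hlt _
  exact hle (Ideal.mul_mem_mul ha (Ideal.mem_span_singleton_self _))

theorem span_range_le_leadIdeal (x : Fin d → R) (α : Fin d → ℕ) :
    Ideal.span (Set.range x) ≤ leadIdeal x α := by
  intro a ha
  rw [mem_leadIdeal, mul_comm]
  refine Ideal.mem_sup_left ?_
  rw [pow_succ]
  exact Ideal.mul_mem_mul (monom_mem_span_pow x α) ha

/-- A relation `a x_i ∈ (x_j, j > i)` trades one factor `x_i` for some `x_j` of larger index. The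
degree is kept and the exponent becomes lexicographically smaller. -/
theorem colon_le_leadIdeal (x : Fin d → R) {α : Fin d → ℕ} {i : Fin d} (hi : 0 < α i) :
    (Ideal.span (x '' {j | i < j})).colon {x i} ≤ leadIdeal x α := by
  intro a ha
  rw [Submodule.mem_colon_singleton, smul_eq_mul] at ha
  have hle : Pi.single i 1 ≤ α := by
    intro j
    by_cases hj : j = i
    · subst hj; simpa using Nat.one_le_iff_ne_zero.mpr hi.ne'
    · simp [hj]
  obtain ⟨β, rfl⟩ := exists_add_of_le hle
  rw [mem_leadIdeal, monom_add, monom_single, ← mul_assoc]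
  refine Ideal.mem_sup_right ?_
  have hmem := Ideal.mul_mem_mul ha (Ideal.mem_span_singleton_self (monom x β))
  rw [Ideal.span_mul_span'] at hmem
  refine Ideal.span_mono ?_ hmem
  rintro _ ⟨_, ⟨j, hj, rfl⟩, _, rfl, rfl⟩
  refine ⟨Pi.single j 1 + β, ⟨?_, ?_⟩, ?_⟩
  · simp [Finset.sum_add_distrib]
  · rw [toLex_add, toLex_add]
    refine add_lt_add_left ?_ _
    refine ⟨i, fun k hk => ?_, ?_⟩
    · have hij : i < j := hj
      simp [hk.ne, (hk.trans hij).ne]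
    · have hij : i < j := hj
      simp [hij.ne]
  · rw [monom_add, monom_single]

/-- `Q^k / Q^{k+1}` is filtered by adding the monomials of degree `k` in lexicographic order; each
factor is cyclic with annihilator `leadIdeal x α`. -/
theorem colength_span_pow_succ (x : Fin d → R) (k : ℕ)
    (hfin : Module.length R (R ⧸ Ideal.span (Set.range x) ^ (k + 1)) ≠ ⊤) :
    colength (Ideal.span (Set.range x) ^ (k + 1)) = colength (Ideal.span (Set.range x) ^ k) +
      ∑ α ∈ Finset.Nat.antidiagonalTuple d k, colength (leadIdeal x α) := by
  have h := colength_eq_sum_colon (ι := Lex (Fin d → ℕ)) (fun α => monom x (ofLex α)) hfin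
    ((Finset.Nat.antidiagonalTuple d k).map toLex.toEmbedding)
  rw [h, Finset.sum_map]
  congr 1
  · congr 1
    have : (fun α : Lex (Fin d → ℕ) => monom x (ofLex α)) ''
        ((Finset.Nat.antidiagonalTuple d k).map toLex.toEmbedding) =
        monom x '' {α | ∑ i, α i = k} := by
      ext r
      simp [Finset.Nat.mem_antidiagonalTuple]
    rw [this, ← span_pow_eq_span_monom]
    exact sup_eq_right.mpr (Ideal.pow_le_pow_right k.le_succ)
  · refine Finset.sum_congr rfl fun α hα => ?_
    rw [Finset.Nat.mem_antidiagonalTuple] at hα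
    have : (fun α : Lex (Fin d → ℕ) => monom x (ofLex α)) '' {j | j ∈
        (Finset.Nat.antidiagonalTuple d k).map toLex.toEmbedding ∧ j < toLex.toEmbedding α} =
        monom x '' {β | ∑ i, β i = ∑ i, α i ∧ toLex β < toLex α} := by
      ext r
      simp only [Set.mem_image, Set.mem_ofPred_eq, Finset.mem_map, Finset.Nat.mem_antidiagonalTuple,
        Equiv.coe_toEmbedding, hα]
      constructor
      · rintro ⟨_, ⟨⟨β, hβ, rfl⟩, hlt⟩, rfl⟩
        exact ⟨β, ⟨hβ, hlt⟩, rfl⟩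
      · rintro ⟨β, ⟨hβ, hlt⟩, rfl⟩
        exact ⟨toLex β, ⟨⟨β, hβ, rfl⟩, hlt⟩, rfl⟩
    refine (congrArg (fun S => colength ((Ideal.span (Set.range x) ^ (k + 1) ⊔
      Ideal.span S).colon {monom x α})) this).trans ?_
    rw [leadIdeal, precedingIdeal, hα]

theorem colength_span_pow_eq_simplexSum (x : Fin d → R)
    (hfin : ∀ k, Module.length R (R ⧸ Ideal.span (Set.range x) ^ k) ≠ ⊤) (n : ℕ) :
    colength (Ideal.span (Set.range x) ^ (n + 1)) =
      simplexSum d (fun α => colength (leadIdeal x α)) n := by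
  induction n with
  | zero =>
    rw [colength_span_pow_succ x 0 (hfin _), pow_zero, Ideal.one_eq_top, colength_top, simplexSum]
    simp
  | succ n ih =>
    rw [colength_span_pow_succ x _ (hfin _), ih, simplexSum, simplexSum,
      Finset.sum_range_succ _ (n + 1)]

/-- The Hilbert function is a simplex sum of an antitone function of the exponent, hence eventually
polynomial. No graded module theory is needed. -/
theorem exists_isHilbertCoeffs (x : Fin d → R) (hd : ringKrullDim R = (d : WithBot ℕ∞))
    (hfin : ∀ k, Module.length R (R ⧸ Ideal.span (Set.range x) ^ k) ≠ ⊤) :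
    ∃ e : ℕ → ℤ, IsHilbertCoeffs (Ideal.span (Set.range x)) e := by
  have hQ : Module.length R (R ⧸ Ideal.span (Set.range x)) ≠ ⊤ := by
    rw [← pow_one (Ideal.span (Set.range x))]
    exact hfin 1
  have hanti : Antitone fun α => (Module.length R (R ⧸ leadIdeal x α)).toNat := by
    intro α β hαβ
    exact Int.ofNat_le.mp (colength_mono (length_quotient_ne_top_of_le hQ
      (span_range_le_leadIdeal x α)) (leadIdeal_mono x hαβ))
  obtain ⟨a, ha⟩ := (eventuallyPoly_simplexSum hanti).exists_coeffs
  refine ⟨fun i => if i ≤ d then (-1) ^ i * a (d - i) else 0, d, hd,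
    fun i hi => if_neg (not_le.mpr hi), ?_⟩
  filter_upwards [ha] with n hn
  have h := colength_span_pow_eq_simplexSum x hfin n
  change colength _ = _
  rw [h]
  refine hn.trans ?_
  rw [← Finset.sum_range_reflect]
  refine Finset.sum_congr rfl fun i hi => ?_
  have hi' : i ≤ d := Nat.lt_succ_iff.mp (Finset.mem_range.mp hi)
  simp only [hi', if_true]
  rw [show d + 1 - 1 - i = d - i by omega, Nat.add_sub_assoc hi', ← mul_assoc, ← pow_add,
    Even.neg_one_pow ⟨i, rfl⟩, one_mul]

end Monomials

/-! ### Growth of binomial coefficients -/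

section Asymptotics

open Filter Topology

theorem tendsto_choose_div_pow_self (j : ℕ) :
    Tendsto (fun n : ℕ => ((n + j).choose j : ℝ) / (n : ℝ) ^ j) atTop
      (𝓝 (1 / (j.factorial : ℝ))) := by
  induction j with
  | zero => simp
  | succ j ih =>
    have h1 : Tendsto (fun n : ℕ => ((n : ℝ) + (j + 1)) / n) atTop (𝓝 1) := by
      have h := (tendsto_const_div_atTop_nhds_zero_nat ((j : ℝ) + 1)).const_add 1
      rw [add_zero] at h
      refine h.congr' ?_
      filter_upwards [eventually_gt_atTop 0] with n hn
      have : (n : ℝ) ≠ 0 := by positivity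
      field_simp
    have h2 := (ih.mul h1).div_const ((j : ℝ) + 1)
    rw [show 1 / (j.factorial : ℝ) * 1 / (j + 1) = 1 / ((j + 1).factorial : ℝ) by
      rw [Nat.factorial_succ]; push_cast; field_simp] at h2
    refine h2.congr' ?_
    filter_upwards [eventually_gt_atTop 0] with n hn
    have hn' : (n : ℝ) ≠ 0 := by positivity
    have h3 : ((n + j + 1 : ℕ) : ℝ) * ((n + j).choose j : ℝ) =
        ((n + (j + 1)).choose (j + 1) : ℝ) * ((j + 1 : ℕ) : ℝ) := by
      exact_mod_cast Nat.add_one_mul_choose_eq (n + j) j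
    push_cast at h3
    have hj : ((j : ℝ) + 1) ≠ 0 := by positivity
    rw [← div_eq_iff hj] at h3
    rw [← h3]
    field_simp
    ring

theorem tendsto_choose_div_pow {j d : ℕ} (h : j < d) :
    Tendsto (fun n : ℕ => ((n + j).choose j : ℝ) / (n : ℝ) ^ d) atTop (𝓝 0) := by
  have h1 : Tendsto (fun n : ℕ => 1 / (n : ℝ) ^ (d - j)) atTop (𝓝 0) := by
    refine (tendsto_inv_atTop_zero.comp ((tendsto_pow_atTop (by omega : d - j ≠ 0)).comp
      (tendsto_natCast_atTop_atTop (R := ℝ)))).congr fun n => ?_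
    simp
  have h2 := (tendsto_choose_div_pow_self j).mul h1
  rw [mul_zero] at h2
  refine h2.congr fun n => ?_
  rw [div_mul_div_comm, mul_one, ← pow_add, Nat.add_sub_cancel' h.le]

theorem tendsto_comp_affine {f : ℕ → ℝ} {d : ℕ} {l : ℝ}
    (hf : Tendsto (fun n : ℕ => f n / (n : ℝ) ^ d) atTop (𝓝 l)) {t : ℕ} (ht : 0 < t) (s : ℕ) :
    Tendsto (fun n : ℕ => f (t * n + s) / (n : ℝ) ^ d) atTop (𝓝 (t ^ d * l)) := by
  have h0 : Tendsto (fun n : ℕ => t * n + s) atTop atTop :=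
    tendsto_atTop_mono 
      (fun n => (Nat.le_mul_of_pos_left n ht).trans (Nat.le_add_right _ _)) tendsto_id
  have h1 : Tendsto (fun n : ℕ => ((t : ℝ) + s / n) ^ d) atTop (𝓝 (t ^ d)) := by
    simpa using ((tendsto_const_div_atTop_nhds_zero_nat (s : ℝ)).const_add (t : ℝ)).pow d
  refine (h1.mul (hf.comp h0)).congr' ?_
  filter_upwards [eventually_gt_atTop 0] with n hn
  have hn' : (n : ℝ) ≠ 0 := by positivity
  have hts : (t : ℝ) * n + s ≠ 0 := by positivity
  simp only [Function.comp_apply]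
  push_cast
  rw [show (t : ℝ) + s / n = (t * n + s) / n by field_simp, div_pow]
  field_simp

end Asymptotics

/-! ### Systems of parameters, multiplicity and a bound for the first Hilbert coefficient -/

section Parameters

open Filter Topology

variable {R : Type*} [CommRing R] {d : ℕ}

/-- Divide each exponent by `t` with remainder. The `d` remainders use up at most `t * d` of the
degree, so the quotients add up to at least `n`. -/
theorem span_pow_le_span_range_pow (x : Fin d → R) {t : ℕ} (ht : 0 < t) (n : ℕ) :
    Ideal.span (Set.range x) ^ (t * n + t * d) ≤
      Ideal.span (Set.range fun i => x i ^ t) ^ n := by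
  rw [span_pow_eq_span_monom, Ideal.span_le]
  rintro _ ⟨α, hα, rfl⟩
  have hα' : ∑ i, α i = t * n + t * d := hα
  have hmon : monom x α = monom (fun i => x i ^ t) (fun i => α i / t) *
      monom x (fun i => α i % t) := by
    simp only [monom, ← Finset.prod_mul_distrib, ← pow_mul, ← pow_add, Nat.div_add_mod]
  have hdeg : n ≤ ∑ i, α i / t := by
    have h1 : ∑ i, α i ≤ ∑ i, (t * (α i / t) + t) :=
      Finset.sum_le_sum fun i _ => by
        conv_lhs => rw [← Nat.div_add_mod (α i) t]
        exact Nat.add_le_add_left (Nat.mod_lt _ ht).le _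
    rw [Finset.sum_add_distrib, ← Finset.mul_sum] at h1
    simp only [Finset.sum_const, Finset.card_univ, Fintype.card_fin, smul_eq_mul] at h1
    have h2 : t * n ≤ t * ∑ i, α i / t := by nlinarith
    exact Nat.le_of_mul_le_mul_left h2 ht
  rw [SetLike.mem_coe, hmon]
  exact Ideal.mul_mem_right _ _ (Ideal.pow_le_pow_right hdeg (monom_mem_span_pow _ _))

theorem span_range_pow_le (x : Fin d → R) (t : ℕ) :
    Ideal.span (Set.range fun i => x i ^ t) ≤ Ideal.span (Set.range x) ^ t := by
  rw [Ideal.span_le]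
  rintro _ ⟨i, rfl⟩
  exact Ideal.pow_mem_pow (Ideal.subset_span (Set.mem_range_self i)) t

variable [IsLocalRing R]

theorem IsSystemOfParameters.mem_maximalIdeal {x : Fin d → R} (hx : IsSystemOfParameters x)
    (i : Fin d) : x i ∈ IsLocalRing.maximalIdeal R := by
  rw [← hx.2]
  exact Ideal.le_radical (Ideal.subset_span ⟨i, rfl⟩)

theorem IsSystemOfParameters.of_mem_radical {x y : Fin d → R} (hx : IsSystemOfParameters x)
    (hy : ∀ i, y i ∈ IsLocalRing.maximalIdeal R)
    (h : ∀ i, x i ∈ (Ideal.span (Set.range y)).radical) : IsSystemOfParameters y := by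
  refine ⟨hx.1, le_antisymm ?_ ?_⟩
  · rw [Ideal.IsPrime.radical_le_iff inferInstance, Ideal.span_le]
    rintro _ ⟨i, rfl⟩
    exact hy i
  · rw [← hx.2, Ideal.radical_le_radical_iff, Ideal.span_le]
    rintro _ ⟨i, rfl⟩
    exact h i

theorem IsSystemOfParameters.pow {x : Fin d → R} (hx : IsSystemOfParameters x) {m : Fin d → ℕ}
    (hm : ∀ i, 0 < m i) : IsSystemOfParameters fun i => x i ^ m i :=
  hx.of_mem_radical (fun i => Ideal.pow_mem_of_mem _ (hx.mem_maximalIdeal i) _ (hm i))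
    fun i => ⟨m i, Ideal.subset_span ⟨i, rfl⟩⟩

variable [IsNoetherianRing R]

theorem IsSystemOfParameters.exists_pow_le {x : Fin d → R} (hx : IsSystemOfParameters x) :
    ∃ N, IsLocalRing.maximalIdeal R ^ N ≤ Ideal.span (Set.range x) := by
  rw [← hx.2]
  exact Ideal.exists_radical_pow_le_of_fg _ (IsNoetherian.noetherian _)

theorem IsSystemOfParameters.length_quotient_pow_ne_top {x : Fin d → R}
    (hx : IsSystemOfParameters x) (k : ℕ) :
    Module.length R (R ⧸ Ideal.span (Set.range x) ^ k) ≠ ⊤ := by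
  obtain ⟨N, hN⟩ := hx.exists_pow_le
  apply length_quotient_ne_top_of_pow_le (n := N * k)
  rw [pow_mul]
  exact Ideal.pow_right_mono hN k

theorem IsSystemOfParameters.length_quotient_ne_top {x : Fin d → R}
    (hx : IsSystemOfParameters x) : Module.length R (R ⧸ Ideal.span (Set.range x)) ≠ ⊤ := by
  obtain ⟨N, hN⟩ := hx.exists_pow_le
  exact length_quotient_ne_top_of_pow_le hN

theorem IsSystemOfParameters.isHilbertCoeffs {x : Fin d → R} (hx : IsSystemOfParameters x) :
    IsHilbertCoeffs (Ideal.span (Set.range x)) (hilbertCoeff (Ideal.span (Set.range x))) := by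
  have h := exists_isHilbertCoeffs x hx.1 hx.length_quotient_pow_ne_top
  have h' : hilbertCoeff (Ideal.span (Set.range x)) = h.choose := by
    funext i
    rw [hilbertCoeff, dif_pos h]
  rw [h']
  exact h.choose_spec

theorem IsSystemOfParameters.eventually_colength_eq {x : Fin d → R}
    (hx : IsSystemOfParameters x) :
    ∀ᶠ n : ℕ in atTop, colength (Ideal.span (Set.range x) ^ (n + 1)) =
      ∑ i ∈ Finset.range (d + 1), (-1) ^ i * hilbertCoeff (Ideal.span (Set.range x)) i *
        ((n + (d - i)).choose (d - i) : ℤ) := by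
  obtain ⟨d', hd', -, h⟩ := hx.isHilbertCoeffs
  obtain rfl : d = d' := by
    have := hx.1.symm.trans hd'
    exact_mod_cast this
  filter_upwards [h] with n hn
  refine hn.trans (Finset.sum_congr rfl fun i hi => ?_)
  rw [Nat.add_sub_assoc (Nat.lt_succ_iff.mp (Finset.mem_range.mp hi))]

theorem IsSystemOfParameters.tendsto_colength {x : Fin d → R} (hx : IsSystemOfParameters x) :
    Tendsto (fun n : ℕ => (colength (Ideal.span (Set.range x) ^ (n + 1)) : ℝ) / (n : ℝ) ^ d) atTop
      (𝓝 (hilbertCoeff (Ideal.span (Set.range x)) 0 * (1 / (d.factorial : ℝ)))) := by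
  set e := hilbertCoeff (Ideal.span (Set.range x))
  have h0 := (tendsto_choose_div_pow_self d).const_mul (e 0 : ℝ)
  have h1 : Tendsto (fun n : ℕ => ∑ i ∈ Finset.range d, ((-1) ^ (i + 1) * (e (i + 1) : ℝ)) *
      (((n + (d - (i + 1))).choose (d - (i + 1)) : ℝ) / (n : ℝ) ^ d)) atTop (𝓝 0) := by
    rw [← Finset.sum_const_zero (s := Finset.range d)]
    refine tendsto_finsetSum _ fun i hi => ?_
    rw [Finset.mem_range] at hi
    simpa using (tendsto_choose_div_pow (by omega : d - (i + 1) < d)).const_mul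
      ((-1) ^ (i + 1) * (e (i + 1) : ℝ))
  have h2 := h1.add h0
  rw [zero_add] at h2
  refine h2.congr' ?_
  filter_upwards [hx.eventually_colength_eq] with n hn
  rw [hn, Finset.sum_range_succ']
  push_cast
  rw [add_div, Finset.sum_div]
  congr 1
  · exact Finset.sum_congr rfl fun i _ => by ring
  · simp; ring

/-- The multiplicity of a parameter ideal when all parameters are replaced by powers. -/
theorem IsSystemOfParameters.hilbertCoeff_zero_pow {x : Fin d → R} (hx : IsSystemOfParameters x)
    {t : ℕ} (ht : 0 < t) :
    hilbertCoeff (Ideal.span (Set.range fun i => x i ^ t)) 0 =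
      t ^ d * hilbertCoeff (Ideal.span (Set.range x)) 0 := by
  -- The powers of the new ideal are squeezed between powers of `Q` whose exponents are `t n` up to
  -- a constant, so the leading terms agree up to the factor `t ^ d`.
  have hxt : IsSystemOfParameters fun i => x i ^ t := hx.pow fun _ => ht
  have h1 := hxt.tendsto_colength
  have h2 := tendsto_comp_affine hx.tendsto_colength ht (t - 1)
  have h3 := tendsto_comp_affine hx.tendsto_colength ht (t - 1 + t * d)
  have hle : ∀ n, colength (Ideal.span (Set.range x) ^ (t * n + (t - 1) + 1)) ≤
      colength (Ideal.span (Set.range fun i => x i ^ t) ^ (n + 1)) := by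
    intro n
    refine colength_mono (hxt.length_quotient_pow_ne_top _) ?_
    rw [show t * n + (t - 1) + 1 = t * (n + 1) by rw [mul_add]; omega, pow_mul]
    exact Ideal.pow_right_mono (span_range_pow_le x t) _
  have hge : ∀ n, colength (Ideal.span (Set.range fun i => x i ^ t) ^ (n + 1)) ≤
      colength (Ideal.span (Set.range x) ^ (t * n + (t - 1 + t * d) + 1)) := by
    intro n
    refine colength_mono (hx.length_quotient_pow_ne_top _) ?_
    rw [show t * n + (t - 1 + t * d) + 1 = t * (n + 1) + t * d by rw [mul_add]; omega]
    exact span_pow_le_span_range_pow x ht _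
  have h4 := le_of_tendsto_of_tendsto' h2 h1 fun n =>
    div_le_div_of_nonneg_right (Int.cast_le.mpr (hle n)) (by positivity)
  have h5 := le_of_tendsto_of_tendsto' h1 h3 fun n =>
    div_le_div_of_nonneg_right (Int.cast_le.mpr (hge n)) (by positivity)
  have h6 := le_antisymm h5 h4
  rw [← mul_assoc] at h6
  have h7 := mul_right_cancel₀ (by positivity) h6
  exact_mod_cast h7

/-- A lower bound for the first Hilbert coefficient. -/
theorem IsSystemOfParameters.le_hilbertCoeff_one {D : ℕ} {x : Fin (D + 2) → R}
    (hx : IsSystemOfParameters x)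
    (h0 : colength ((Ideal.span (x '' {j | 0 < j})).colon {x 0} ⊔ Ideal.span (Set.range x)) =
      hilbertCoeff (Ideal.span (Set.range x)) 0) :
    hilbertCoeff (Ideal.span (Set.range x)) 0 -
      colength ((Ideal.span (x '' {j | 1 < j})).colon {x 1} ⊔ Ideal.span (Set.range x)) ≤
      hilbertCoeff (Ideal.span (Set.range x)) 1 := by
  set e := hilbertCoeff (Ideal.span (Set.range x)) with he
  set b := colength ((Ideal.span (x '' {j | 1 < j})).colon {x 1} ⊔ Ideal.span (Set.range x)) with hb
  set a := colength (Ideal.span (Set.range x)) with ha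
  have hQ := hx.length_quotient_ne_top
  have hbound := fun n => simplexSum_le (D := D) (g := fun α => colength (leadIdeal x α))
    (a := a) (b := b) (e := e 0)
    (fun α => colength_mono hQ (span_range_le_leadIdeal x α))
    (fun α hα => colength_mono (length_quotient_ne_top_of_le hQ le_sup_right)
      (sup_le (colon_le_leadIdeal x hα) (span_range_le_leadIdeal x α)))
    (fun α hα => h0 ▸ colength_mono (length_quotient_ne_top_of_le hQ le_sup_right)
      (sup_le (colon_le_leadIdeal x hα) (span_range_le_leadIdeal x α))) n
  have hev : ∀ᶠ n : ℕ in atTop, (-(e 1 : ℝ)) * (((n + (D + 1)).choose (D + 1) : ℝ) / n ^ (D + 1)) +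
      ∑ i ∈ Finset.range (D + 1), ((-1) ^ (i + 2) * (e (i + 2) : ℝ)) *
        (((n + (D - i)).choose (D - i) : ℝ) / (n : ℝ) ^ (D + 1)) ≤
      ((b : ℝ) - e 0) * (((n + (D + 1)).choose (D + 1) : ℝ) / n ^ (D + 1)) +
        ((a : ℝ) - b) * (((n + D).choose D : ℝ) / n ^ (D + 1)) := by
    filter_upwards [hx.eventually_colength_eq, eventually_gt_atTop 0] with n hn hpos
    obtain ⟨m, rfl⟩ : ∃ m, n = m + 1 := ⟨n - 1, by omega⟩
    have h1 := hbound m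
    rw [← colength_span_pow_eq_simplexSum x hx.length_quotient_pow_ne_top, hn,
      Finset.sum_range_succ', Finset.sum_range_succ'] at h1
    have p1 : (((m + 1 + (D + 2)).choose (D + 2) : ℕ) : ℤ) =
        ((m + 1 + (D + 1)).choose (D + 1) : ℤ) + ((m + (D + 2)).choose (D + 2) : ℤ) := by
      rw [show m + 1 + (D + 2) = m + 1 + (D + 1) + 1 by ring,
        Nat.choose_succ_succ' (m + 1 + (D + 1)) (D + 1),
        show m + 1 + (D + 1) = m + (D + 2) by ring]
      push_cast
      ring
    have p2 : (((m + 1 + (D + 1)).choose (D + 1) : ℕ) : ℤ) =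
        ((m + 1 + D).choose D : ℤ) + ((m + (D + 1)).choose (D + 1) : ℤ) := by
      rw [show m + 1 + (D + 1) = m + 1 + D + 1 by ring, Nat.choose_succ_succ' (m + 1 + D) D,
        show m + 1 + D = m + (D + 1) by ring]
      push_cast
      ring
    -- Pascal's rule brings both sides to the same arguments and cancels the leading terms with
    -- coefficient `e 0`; dividing by `n ^ (D + 1)` and passing to the limit isolates `-e 1 ≤ b - e
    -- 0`.
    have h2 : -e 1 * ((m + 1 + (D + 1)).choose (D + 1) : ℤ) +
        ∑ i ∈ Finset.range (D + 1), (-1) ^ (i + 2) * e (i + 2) *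
          ((m + 1 + (D - i)).choose (D - i) : ℤ) ≤
        (b - e 0) * ((m + 1 + (D + 1)).choose (D + 1) : ℤ) +
          (a - b) * ((m + 1 + D).choose D : ℤ) := by
      have hs : ∀ i, D + 2 - (i + 1 + 1) = D - i := fun i => by omega
      simp only [hs, zero_add, Nat.sub_zero, pow_zero, one_mul, pow_one,
        show D + 2 - 1 = D + 1 from rfl, add_assoc, Nat.reduceAdd] at h1
      simp only [add_assoc] at p1 p2 ⊢
      linear_combination h1 - e 0 * p1 - b * p2
    have hc : (0 : ℝ) < ((m + 1 : ℕ) : ℝ) ^ (D + 1) := by positivity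
    have h3 : (-(e 1 : ℝ)) * ((m + 1 + (D + 1)).choose (D + 1) : ℝ) +
        ∑ i ∈ Finset.range (D + 1), (-1) ^ (i + 2) * (e (i + 2) : ℝ) *
          ((m + 1 + (D - i)).choose (D - i) : ℝ) ≤
        ((b : ℝ) - e 0) * ((m + 1 + (D + 1)).choose (D + 1) : ℝ) +
          ((a : ℝ) - b) * ((m + 1 + D).choose D : ℝ) := by exact_mod_cast h2
    have h4 := div_le_div_of_nonneg_right h3 hc.le
    rw [add_div, add_div, Finset.sum_div] at h4
    simpa only [mul_div_assoc] using h4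
  have hz : Tendsto (fun n : ℕ => ∑ i ∈ Finset.range (D + 1), ((-1) ^ (i + 2) * (e (i + 2) : ℝ)) *
      (((n + (D - i)).choose (D - i) : ℝ) / (n : ℝ) ^ (D + 1))) atTop (𝓝 0) := by
    rw [← Finset.sum_const_zero (s := Finset.range (D + 1))]
    refine tendsto_finsetSum _ fun i hi => ?_
    simpa using (tendsto_choose_div_pow (by omega : D - i < D + 1)).const_mul
      ((-1) ^ (i + 2) * (e (i + 2) : ℝ))
  have hself := tendsto_choose_div_pow_self (D + 1)
  have h5 := le_of_tendsto_of_tendsto ((hself.const_mul (-(e 1 : ℝ))).add hz)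
    ((hself.const_mul ((b : ℝ) - e 0)).add
      ((tendsto_choose_div_pow (Nat.lt_succ_self D)).const_mul ((a : ℝ) - b))) hev
  rw [add_zero, mul_zero, add_zero] at h5
  have h6 := le_of_mul_le_mul_right h5 (by positivity)
  have h7 : -e 1 ≤ b - e 0 := by exact_mod_cast h6
  linarith

end Parameters

/-! ### Colon ideals of powers of one element -/

section Colon

variable {R : Type*} [CommRing R]

theorem mem_sup_span_singleton {P : Ideal R} {y a : R} :
    a ∈ P ⊔ Ideal.span {y} ↔ ∃ r, a - r * y ∈ P := by
  rw [sup_comm, Ideal.mem_span_singleton_sup]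
  constructor
  · rintro ⟨r, b, hb, rfl⟩
    exact ⟨r, by simpa using hb⟩
  · rintro ⟨r, hr⟩
    exact ⟨r, a - r * y, hr, by ring⟩

theorem mem_colon_singleton_iff_mul_mem {P : Ideal R} {y a : R} :
    a ∈ P.colon {y} ↔ a * y ∈ P := by
  rw [Submodule.mem_colon_singleton, smul_eq_mul]

theorem colength_sup_span_pow_le {P : Ideal R} {y : R}
    (hfin : ∀ n, Module.length R (R ⧸ (P ⊔ Ideal.span {y ^ n})) ≠ ⊤) (m : ℕ) :
    colength (P ⊔ Ideal.span {y ^ m}) ≤ m * colength (P ⊔ Ideal.span {y}) := by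
  induction m with
  | zero => simp [colength_top]
  | succ m ih =>
    have h1 : P ⊔ Ideal.span {y} ≤ (P ⊔ Ideal.span {y ^ (m + 1)}).colon {y ^ m} := by
      refine sup_le (fun a ha => ?_) ((Ideal.span_singleton_le_iff_mem _).mpr ?_)
      · rw [Submodule.mem_colon_singleton, smul_eq_mul]
        exact Ideal.mem_sup_left (P.mul_mem_right _ ha)
      · rw [Submodule.mem_colon_singleton, smul_eq_mul, ← pow_succ']
        exact Ideal.mem_sup_right (Ideal.mem_span_singleton_self _)
    have h2 : P ⊔ Ideal.span {y ^ m} ≤ P ⊔ Ideal.span {y ^ (m + 1)} ⊔ Ideal.span {y ^ m} :=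
      sup_le_sup_right le_sup_left _
    have h3 := colength_mono (hfin m) h2
    have hy := hfin 1
    rw [pow_one] at hy
    have h4 := colength_mono hy h1
    rw [colength_eq_add_colon (hfin (m + 1)) (y ^ m)]
    push_cast
    linarith

/-- The last step of the `y`-adic filtration of `R/(P, y^{n+1})` is generated by `y^n`, with
annihilator `(P : y^n) + (y)`. -/
theorem colength_sup_span_pow_succ {P : Ideal R} {y : R}
    (hfin : ∀ n, Module.length R (R ⧸ (P ⊔ Ideal.span {y ^ n})) ≠ ⊤) (n : ℕ) :
    colength (P ⊔ Ideal.span {y ^ (n + 1)}) =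
      colength (P ⊔ Ideal.span {y ^ n}) + colength (P.colon {y ^ n} ⊔ Ideal.span {y}) := by
  rw [colength_eq_add_colon (hfin (n + 1)) (y ^ n)]
  congr 2
  · rw [sup_assoc]
    congr 1
    exact sup_eq_right.mpr (Ideal.span_singleton_le_span_singleton.mpr (pow_dvd_pow y n.le_succ))
  · ext a
    rw [mem_colon_singleton_iff_mul_mem, mem_sup_span_singleton, mem_sup_span_singleton]
    refine exists_congr fun r => ?_
    rw [mem_colon_singleton_iff_mul_mem, show a * y ^ n - r * y ^ (n + 1) = (a - r * y) * y ^ n by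
      ring]

/-- If the colon ideals `P : y ^ n` agree modulo `y`, then they agree. -/
theorem mul_mem_of_mul_sq_mem [IsLocalRing R] [IsNoetherianRing R] {P : Ideal R} {y : R}
    (hy : y ∈ IsLocalRing.maximalIdeal R)
    (h : ∀ n, 0 < n → P.colon {y ^ n} ≤ P.colon {y} ⊔ Ideal.span {y}) {a : R}
    (ha : a * y ^ 2 ∈ P) : a * y ∈ P := by
  have hmono : Monotone fun n => P.colon {y ^ n} := by
    refine monotone_nat_of_le_succ fun n b hb => ?_
    rw [mem_colon_singleton_iff_mul_mem] at hb ⊢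
    rw [pow_succ, ← mul_assoc]
    exact P.mul_mem_right _ hb
  obtain ⟨N, hN⟩ := monotone_stabilizes_iff_noetherian.mpr ‹IsNoetherianRing R› ⟨_, hmono⟩
  have hN' : ∀ m, N ≤ m → P.colon {y ^ N} = P.colon {y ^ m} := hN
  set M := N + 2 with hM
  have hstab : P.colon {y ^ (M + 1)} = P.colon {y ^ M} := by
    rw [← hN' (M + 1) (by omega), ← hN' M (by omega)]
  -- For `b ∈ P : y^M` write `b = b' + r y` with `b' ∈ P : y`. Then `r y^{M+1} ∈ P`, so stability
  -- puts `r` in `P : y^M`. Thus `P : y^M ⊆ (P : y) + 𝔪 (P : y^M)`, and Nakayama applies.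
  have key : P.colon {y ^ M} ≤ P.colon {y} := by
    refine Submodule.le_of_le_smul_of_le_jacobson_bot (I := IsLocalRing.maximalIdeal R)
      (IsNoetherian.noetherian _) (IsLocalRing.maximalIdeal_le_jacobson _) fun b hb => ?_
    obtain ⟨r, hr⟩ := mem_sup_span_singleton.mp (h M (by omega) hb)
    have h1 : b - r * y ∈ P.colon {y ^ M} := by
      have : P.colon {y} ≤ P.colon {y ^ M} := by simpa using hmono (by omega : 1 ≤ M)
      exact this hr
    have h2 : r ∈ P.colon {y ^ M} := by
      rw [← hstab, mem_colon_singleton_iff_mul_mem, pow_succ', ← mul_assoc,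
        ← mem_colon_singleton_iff_mul_mem]
      simpa using sub_mem hb h1
    rw [← sub_add_cancel b (r * y), mul_comm r y]
    rw [mul_comm r y] at hr
    exact add_mem (Submodule.mem_sup_left hr)
      (Submodule.mem_sup_right (Submodule.smul_mem_smul hy h2))
  exact mem_colon_singleton_iff_mul_mem.mp
    (key (hmono (by omega : 2 ≤ M) (mem_colon_singleton_iff_mul_mem.mpr ha)))

theorem span_range_update {d : ℕ} (x : Fin d → R) (i : Fin d) (a : R) :
    Ideal.span (Set.range (Function.update x i a)) =
      Ideal.span (x '' {i}ᶜ) ⊔ Ideal.span {a} := by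
  rw [← Ideal.span_union]
  congr 1
  ext r
  simp only [Set.mem_range, Set.mem_union, Set.mem_image, Set.mem_compl_iff, Set.mem_singleton_iff]
  constructor
  · rintro ⟨j, rfl⟩
    by_cases hj : j = i
    · subst hj; simp
    · exact Or.inl ⟨j, hj, by simp [hj]⟩
  · rintro (⟨j, hj, rfl⟩ | rfl)
    · exact ⟨j, by simp [hj]⟩
    · exact ⟨i, by simp⟩

theorem span_range_eq_sup {d : ℕ} (x : Fin d → R) (i : Fin d) :
    Ideal.span (Set.range x) = Ideal.span (x '' {i}ᶜ) ⊔ Ideal.span {x i} := by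
  rw [← span_range_update, Function.update_eq_self]

theorem span_image_insert {ι : Type*} (x : ι → R) (i : ι) (J : Set ι) :
    Ideal.span (x '' insert i J) = Ideal.span (x '' J) ⊔ Ideal.span {x i} := by
  rw [Set.image_insert_eq, Ideal.span_insert, sup_comm]

end Colon

/-! ### Multiplicities and colons of parameters in a Buchsbaum ring -/

section Buchsbaum

variable {R : Type*} [CommRing R] [IsLocalRing R] {d : ℕ} {c : ℤ}

/-- The multiplicity of the parameter ideal generated by `x`. -/
noncomputable abbrev paramMult (x : Fin d → R) : ℤ := hilbertCoeff (Ideal.span (Set.range x)) 0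

theorem colength_eq_paramMult_add
    (hB : ∀ Q : Ideal R, IsParameterIdeal Q → lengthInt R (R ⧸ Q) - hilbertCoeff Q 0 = c)
    {x : Fin d → R} (hx : IsSystemOfParameters x) :
    colength (Ideal.span (Set.range x)) = paramMult x + c := by
  have := hB _ ⟨d, x, hx, rfl⟩
  rw [← this]
  simp

theorem IsSystemOfParameters.update_pow {x : Fin d → R} (hx : IsSystemOfParameters x) (i : Fin d)
    {m : ℕ} (hm : 0 < m) : IsSystemOfParameters (Function.update x i (x i ^ m)) := by
  have h := hx.pow (m := Function.update 1 i m) fun j => by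
    by_cases hj : j = i
    · subst hj; simpa using hm
    · simp [hj]
  convert h using 1
  funext j
  by_cases hj : j = i
  · subst hj; simp
  · simp [hj]

variable [IsNoetherianRing R]

theorem IsSystemOfParameters.length_quotient_sup_span_pow_ne_top {x : Fin d → R}
    (hx : IsSystemOfParameters x) (i : Fin d) (n : ℕ) :
    Module.length R (R ⧸ (Ideal.span (x '' {i}ᶜ) ⊔ Ideal.span {x i ^ n})) ≠ ⊤ := by
  refine length_quotient_ne_top_of_le (hx.update_pow i n.succ_pos).length_quotient_ne_top ?_
  rw [span_range_update]
  exact sup_le_sup_left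
    (Ideal.span_singleton_le_span_singleton.mpr (pow_dvd_pow _ n.le_succ)) _

/-- The length inequality for `x_i ^ m` gives the claim up to the error `(m - 1) c`. Raising all
parameters to the power `t` scales both multiplicities by `t ^ d` and leaves the error fixed, so the
error disappears for large `t`. -/
theorem paramMult_update_pow_le
    (hB : ∀ Q : Ideal R, IsParameterIdeal Q → lengthInt R (R ⧸ Q) - hilbertCoeff Q 0 = c)
    {x : Fin d → R} (hx : IsSystemOfParameters x) (i : Fin d) {m : ℕ} (hm : 0 < m) :
    paramMult (Function.update x i (x i ^ m)) ≤ m * paramMult x := by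
  have hd : d ≠ 0 := by rintro rfl; exact i.elim0
  have key : ∀ t : ℕ, 0 < t →
      (t : ℤ) ^ d * (paramMult (Function.update x i (x i ^ m)) - m * paramMult x) ≤ (m - 1) * c := by
    intro t ht
    have hxt : IsSystemOfParameters fun j => x j ^ t := hx.pow fun _ => ht
    have h1 : (fun j => Function.update x i (x i ^ m) j ^ t) =
        Function.update (fun j => x j ^ t) i ((x i ^ t) ^ m) := by
      funext j
      by_cases hj : j = i
      · subst hj; simp [← pow_mul, mul_comm]
      · simp [hj]
    have h2 := colength_eq_paramMult_add hB (hxt.update_pow i hm)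
    have h3 := colength_eq_paramMult_add hB hxt
    have h4 := colength_sup_span_pow_le (hxt.length_quotient_sup_span_pow_ne_top i) m
    rw [← span_range_update, ← span_range_eq_sup (fun j => x j ^ t) i, h2, h3] at h4
    rw [← h1, paramMult, (hx.update_pow i hm).hilbertCoeff_zero_pow ht, paramMult,
      hx.hilbertCoeff_zero_pow ht] at h4
    linear_combination h4
  by_contra! hlt
  -- This `t` exceeds `(m - 1) c`, and `t ≤ t ^ d` because `d ≠ 0`.
  have h1 := key ((m - 1) * c).natAbs.succ (Nat.succ_pos _)
  have h2 : ((((m : ℤ) - 1) * c).natAbs.succ : ℤ) ≤ ((((m : ℤ) - 1) * c).natAbs.succ : ℤ) ^ d :=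
    le_self_pow₀ (by exact_mod_cast Nat.succ_pos _) hd
  have h3 : ((m : ℤ) - 1) * c < ((((m : ℤ) - 1) * c).natAbs.succ : ℤ) := by
    have := Int.le_natAbs (a := ((m : ℤ) - 1) * c)
    rw [Nat.succ_eq_add_one, Nat.cast_add_one]
    linarith
  have h4 : ((((m : ℤ) - 1) * c).natAbs.succ : ℤ) ^ d ≤ ((((m : ℤ) - 1) * c).natAbs.succ : ℤ) ^ d *
      (paramMult (Function.update x i (x i ^ m)) - m * paramMult x) :=
    le_mul_of_one_le_right (by positivity) (by linarith)
  linarith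

theorem paramMult_piecewise_pow_le
    (hB : ∀ Q : Ideal R, IsParameterIdeal Q → lengthInt R (R ⧸ Q) - hilbertCoeff Q 0 = c)
    {x : Fin d → R} (hx : IsSystemOfParameters x) {m : ℕ} (hm : 0 < m) (s : Finset (Fin d)) :
    IsSystemOfParameters (s.piecewise (fun j => x j ^ m) x) ∧
      paramMult (s.piecewise (fun j => x j ^ m) x) ≤ m ^ s.card * paramMult x := by
  induction s using Finset.induction_on with
  | empty => simpa using hx
  | insert i s hi ih =>
    have h : (insert i s).piecewise (fun j => x j ^ m) x = Function.update
        (s.piecewise (fun j => x j ^ m) x) i ((s.piecewise (fun j => x j ^ m) x) i ^ m) := by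
      rw [Finset.piecewise_insert, Finset.piecewise_eq_of_notMem _ _ _ hi]
    rw [h]
    refine ⟨ih.1.update_pow i hm, (paramMult_update_pow_le hB ih.1 i hm).trans ?_⟩
    rw [Finset.card_insert_of_notMem hi, pow_succ', mul_assoc]
    exact mul_le_mul_of_nonneg_left ih.2 (by positivity)

/-- Raising the remaining `d - 1` parameters to the power `m` costs a factor of at most `m ^ (d -
1)`, while raising all of them gives exactly `m ^ d`. This forces the missing inequality. -/
theorem paramMult_update_pow
    (hB : ∀ Q : Ideal R, IsParameterIdeal Q → lengthInt R (R ⧸ Q) - hilbertCoeff Q 0 = c)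
    {x : Fin d → R} (hx : IsSystemOfParameters x) (i : Fin d) {m : ℕ} (hm : 0 < m) :
    paramMult (Function.update x i (x i ^ m)) = m * paramMult x := by
  refine le_antisymm (paramMult_update_pow_le hB hx i hm) ?_
  have h1 := (paramMult_piecewise_pow_le hB (hx.update_pow i hm) hm (Finset.univ.erase i)).2
  have h2 : (Finset.univ.erase i).piecewise (fun j => Function.update x i (x i ^ m) j ^ m)
      (Function.update x i (x i ^ m)) = fun j => x j ^ m := by
    funext j
    by_cases hj : j = i
    · subst hj; simp
    · simp [hj]
  rw [h2, paramMult, hx.hilbertCoeff_zero_pow hm, Finset.card_erase_of_mem (Finset.mem_univ i),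
    Finset.card_univ, Fintype.card_fin] at h1
  have hd : d = d - 1 + 1 := by have := i.pos; omega
  rw [show (m : ℤ) ^ d = m ^ (d - 1) * m by rw [← pow_succ, ← hd], mul_assoc] at h1
  exact le_of_mul_le_mul_left h1 (by positivity)

/-- The lengths of `R/(P, x_i^m)` equal `m e_0 + c`, and the left side is the difference of two
consecutive ones. -/
theorem colength_colon_pow_sup
    (hB : ∀ Q : Ideal R, IsParameterIdeal Q → lengthInt R (R ⧸ Q) - hilbertCoeff Q 0 = c)
    {x : Fin d → R} (hx : IsSystemOfParameters x) (i : Fin d) {n : ℕ} (hn : 0 < n) :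
    colength ((Ideal.span (x '' {i}ᶜ)).colon {x i ^ n} ⊔ Ideal.span {x i}) = paramMult x := by
  have h := colength_sup_span_pow_succ (hx.length_quotient_sup_span_pow_ne_top i) n
  have key : ∀ m : ℕ, 0 < m →
      colength (Ideal.span (x '' {i}ᶜ) ⊔ Ideal.span {x i ^ m}) = m * paramMult x + c := by
    intro m hm
    rw [← span_range_update, colength_eq_paramMult_add hB (hx.update_pow i hm),
      paramMult_update_pow hB hx i hm]
  rw [key n hn, key (n + 1) n.succ_pos] at h
  push_cast at h
  linarith

/-- The ideals `(P : x_i^n) + (x_i)` contain the one for `n = 1` and have the same colength, so they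
all coincide; this is what `mul_mem_of_mul_sq_mem` needs. -/
theorem mul_param_mem_of_mul_sq_mem
    (hB : ∀ Q : Ideal R, IsParameterIdeal Q → lengthInt R (R ⧸ Q) - hilbertCoeff Q 0 = c)
    {x : Fin d → R} (hx : IsSystemOfParameters x) (i : Fin d) {a : R}
    (ha : a * x i ^ 2 ∈ Ideal.span (x '' {i}ᶜ)) : a * x i ∈ Ideal.span (x '' {i}ᶜ) := by
  refine mul_mem_of_mul_sq_mem (hx.mem_maximalIdeal i) (fun n hn => ?_) ha
  have hfin := hx.length_quotient_sup_span_pow_ne_top i 1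
  rw [pow_one] at hfin
  have hle : (Ideal.span (x '' {i}ᶜ)) ≤ (Ideal.span (x '' {i}ᶜ)).colon {x i} := fun b hb =>
    mem_colon_singleton_iff_mul_mem.mpr (Ideal.mul_mem_right _ _ hb)
  have h1 : (Ideal.span (x '' {i}ᶜ)).colon {x i} ⊔ Ideal.span {x i} ≤
      (Ideal.span (x '' {i}ᶜ)).colon {x i ^ n} ⊔ Ideal.span {x i} := by
    refine sup_le_sup_right (fun b hb => ?_) _
    rw [mem_colon_singleton_iff_mul_mem] at hb ⊢
    obtain ⟨k, rfl⟩ : ∃ k, n = k + 1 := ⟨n - 1, by omega⟩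
    rw [pow_succ', ← mul_assoc]
    exact Ideal.mul_mem_right _ _ hb
  have h2 := colength_colon_pow_sup hB hx i one_pos
  rw [pow_one] at h2
  rw [eq_of_colength_le (length_quotient_ne_top_of_le hfin (sup_le_sup_right hle _)) h1
    (by rw [h2, colength_colon_pow_sup hB hx i hn])]
  exact le_sup_left

theorem mul_param_mem_of_mul_pow_mem
    (hB : ∀ Q : Ideal R, IsParameterIdeal Q → lengthInt R (R ⧸ Q) - hilbertCoeff Q 0 = c)
    {x : Fin d → R} (hx : IsSystemOfParameters x) (i : Fin d) {n : ℕ} {a : R}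
    (ha : a * x i ^ n ∈ Ideal.span (x '' {i}ᶜ)) : a * x i ∈ Ideal.span (x '' {i}ᶜ) := by
  induction n with
  | zero => exact Ideal.mul_mem_right _ _ (by simpa using ha)
  | succ n ih =>
    cases n with
    | zero => simpa using ha
    | succ n =>
      apply ih
      rw [pow_succ, ← mul_assoc]
      refine mul_param_mem_of_mul_sq_mem hB hx i ?_
      convert ha using 1
      ring

end Buchsbaum

/-! ### Partial systems of parameters and the limit closure -/

section ParameterColon

variable {R : Type*} [CommRing R] {d : ℕ}

open Classical in
/-- Replace the parameters outside `J ∪ {i}` by their `n`-th powers. -/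
noncomputable def powOutside (x : Fin d → R) (J : Set (Fin d)) (i : Fin d) (n : ℕ) : Fin d → R :=
  fun j => if j ∈ J ∨ j = i then x j else x j ^ n

theorem span_le_span_powOutside (x : Fin d → R) {J : Set (Fin d)} {i : Fin d} (hi : i ∉ J) (n : ℕ) :
    Ideal.span (x '' J) ≤ Ideal.span (powOutside x J i n '' {i}ᶜ) := by
  refine Ideal.span_mono ?_
  rintro _ ⟨j, hj, rfl⟩
  exact ⟨j, fun h => hi (h ▸ hj), by simp [powOutside, hj]⟩

theorem span_image_compl_singleton (x : Fin d → R) {i j : Fin d} (hij : i ≠ j) :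
    Ideal.span (x '' {i}ᶜ) = Ideal.span (x '' {i, j}ᶜ) ⊔ Ideal.span {x j} := by
  rw [← span_image_insert]
  congr 2
  ext k
  simp only [Set.mem_compl_iff, Set.mem_singleton_iff, Set.mem_insert_iff]
  by_cases hk : k = j
  · simp [hk, hij.symm]
  · simp [hk]

/-- The ideal `((x_j, j ≠ i) : x_i) + Q`. -/
def colonSup (x : Fin d → R) (i : Fin d) : Ideal R :=
  (Ideal.span (x '' {i}ᶜ)).colon {x i} ⊔ Ideal.span (Set.range x)

theorem span_range_le_limitClosure (x : Fin d → R) :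
    Ideal.span (Set.range x) ≤ limitClosure x := by
  intro a ha
  exact ⟨0, by simpa using ha⟩

/-- The exponent `1` suffices: the factor `x_i` of the product moves `a` into `(x_j, j ∈ J)`, and
the remaining factors square each of these generators. -/
theorem mem_limitClosure_of_mul_param_mem (x : Fin d → R) {J : Set (Fin d)} {i : Fin d}
    (hi : i ∉ J) {a : R} (ha : a * x i ∈ Ideal.span (x '' J)) : a ∈ limitClosure x := by
  refine ⟨1, ?_⟩
  rw [pow_one, ← Finset.mul_prod_erase _ _ (Finset.mem_univ i), ← mul_assoc]
  refine Submodule.span_induction (p := fun b _ => b * ∏ j ∈ Finset.univ.erase i, x j ∈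
    Ideal.span (Set.range fun i => x i ^ (1 + 1))) ?_ ?_ ?_ ?_ ha
  · rintro _ ⟨j, hj, rfl⟩
    have hmem : j ∈ Finset.univ.erase i := by
      simp only [Finset.mem_erase, Finset.mem_univ, and_true]
      rintro rfl
      exact hi hj
    rw [← Finset.mul_prod_erase _ _ hmem, ← mul_assoc, ← pow_two]
    exact Ideal.mul_mem_right _ _ (Ideal.subset_span ⟨j, rfl⟩)
  · simp
  · intro b b' _ _ hb hb'
    rw [add_mul]
    exact add_mem hb hb'
  · intro r b _ hb
    rw [smul_eq_mul, mul_assoc]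
    exact Ideal.mul_mem_left _ _ hb

theorem colonSup_le_limitClosure (x : Fin d → R) (i : Fin d) : colonSup x i ≤ limitClosure x :=
  sup_le (fun _ ha => mem_limitClosure_of_mul_param_mem x (J := {i}ᶜ) (by simp)
    (mem_colon_singleton_iff_mul_mem.mp ha)) (span_range_le_limitClosure x)

variable [IsLocalRing R]

theorem IsSystemOfParameters.powOutside {x : Fin d → R} (hx : IsSystemOfParameters x)
    (J : Set (Fin d)) (i : Fin d) {n : ℕ} (hn : 0 < n) :
    IsSystemOfParameters (powOutside x J i n) := by
  classical
  have h := hx.pow (m := fun j => if j ∈ J ∨ j = i then 1 else n) fun j => by split_ifs <;> omega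
  convert h using 1
  funext j
  simp only [_root_.powOutside]
  split_ifs <;> simp

end ParameterColon

/-! ### Colons of partial systems of parameters and the length estimate -/

section BuchsbaumColon

variable {R : Type*} [CommRing R] [IsLocalRing R] [IsNoetherianRing R] {d : ℕ} {c : ℤ}

theorem mem_of_forall_mem_sup_pow {P : Ideal R} {b : R}
    (h : ∀ n, 0 < n → b ∈ P ⊔ IsLocalRing.maximalIdeal R ^ n) : b ∈ P := by
  rw [← Submodule.Quotient.mk_eq_zero P, ← Submodule.mem_bot R,
    ← Ideal.iInf_pow_smul_eq_bot_of_isLocalRing (M := R ⧸ P) (IsLocalRing.maximalIdeal R)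
      Ideal.IsPrime.ne_top', Submodule.mem_iInf]
  intro n
  obtain ⟨p, hp, q, hq, hpq⟩ := Submodule.mem_sup.mp (h (n + 1) n.succ_pos)
  have hb : (Submodule.Quotient.mk b : R ⧸ P) = q • Submodule.Quotient.mk (1 : R) := by
    rw [← Submodule.Quotient.mk_smul, Submodule.Quotient.eq, ← hpq]
    simpa using hp
  rw [hb]
  exact Submodule.smul_mem_smul (Ideal.pow_le_pow_right n.le_succ hq) Submodule.mem_top

/-- Krull's intersection theorem modulo `(x_j, j ∈ J)`: the other generators lie in ever higher
powers of the maximal ideal. This transfers statements on `d - 1` parameters to arbitrary subsets.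
-/
theorem mem_of_forall_mem_span_powOutside {x : Fin d → R} (hx : IsSystemOfParameters x)
    {J : Set (Fin d)} {i : Fin d} {b : R}
    (h : ∀ n, 0 < n → b ∈ Ideal.span (powOutside x J i n '' {i}ᶜ)) : b ∈ Ideal.span (x '' J) := by
  refine mem_of_forall_mem_sup_pow fun n hn => ?_
  refine (Ideal.span_le.mpr ?_ : Ideal.span (powOutside x J i n '' {i}ᶜ) ≤ _) (h n hn)
  rintro _ ⟨j, hj, rfl⟩
  by_cases hJ : j ∈ J
  · refine Ideal.mem_sup_left (Ideal.subset_span ⟨j, hJ, by simp [powOutside, hJ]⟩)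
  · refine Ideal.mem_sup_right ?_
    have hj' : j ≠ i := hj
    simpa [powOutside, hJ, hj'] using Ideal.pow_mem_pow (hx.mem_maximalIdeal j) n

theorem mul_param_mem_span_of_mul_sq_mem
    (hB : ∀ Q : Ideal R, IsParameterIdeal Q → lengthInt R (R ⧸ Q) - hilbertCoeff Q 0 = c)
    {x : Fin d → R} (hx : IsSystemOfParameters x) {J : Set (Fin d)} {i : Fin d} (hi : i ∉ J) {a : R}
    (ha : a * x i ^ 2 ∈ Ideal.span (x '' J)) : a * x i ∈ Ideal.span (x '' J) := by
  refine mem_of_forall_mem_span_powOutside hx (i := i) fun n hn => ?_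
  have h := mul_param_mem_of_mul_sq_mem hB (hx.powOutside J i hn) i (a := a)
  simp only [show powOutside x J i n i = x i by simp [powOutside]] at h
  exact h (span_le_span_powOutside x hi n ha)

/-- Replace `x_i` by `x_i + x_j` while `x_j^n` is among the other parameters. Modulo these, `a (x_i
+ x_j)^n` is a multiple of `a x_i`, hence zero, so already `a (x_i + x_j)` vanishes. Subtract `a
x_i` and let `n` grow. -/
theorem mul_param_mem_span_of_mul_param_mem
    (hB : ∀ Q : Ideal R, IsParameterIdeal Q → lengthInt R (R ⧸ Q) - hilbertCoeff Q 0 = c)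
    {x : Fin d → R} (hx : IsSystemOfParameters x) {J : Set (Fin d)} {i j : Fin d} (hi : i ∉ J)
    (hj : j ∉ J) {a : R} (ha : a * x i ∈ Ideal.span (x '' J)) : a * x j ∈ Ideal.span (x '' J) := by
  by_cases hij : j = i
  · rwa [hij]
  refine mem_of_forall_mem_span_powOutside hx (i := i) fun n hn => ?_
  set y := powOutside x J i n with hy
  have hyx := hx.powOutside J i hn
  have hyi : y i = x i := by simp [hy, powOutside]
  have hyj : y j = x j ^ n := by simp [hy, powOutside, hj, hij]
  have himage : Function.update y i (x i + x j) '' {i}ᶜ = y '' {i}ᶜ :=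
    Set.image_congr fun k hk => Function.update_of_ne hk _ _
  have hz : IsSystemOfParameters (Function.update y i (x i + x j)) := by
    have hother : ∀ k, k ≠ i → y k ∈
        Ideal.span (Set.range (Function.update y i (x i + x j))) := fun k hk =>
      Ideal.subset_span ⟨k, Function.update_of_ne hk _ _⟩
    refine hyx.of_mem_radical (fun k => ?_) fun k => ?_
    · by_cases hk : k = i
      · subst hk
        simpa using add_mem (hx.mem_maximalIdeal k) (hx.mem_maximalIdeal j)
      · simpa [hk] using hyx.mem_maximalIdeal k
    · by_cases hk : k = i
      · subst hk
        have h1 : x j ∈ (Ideal.span (Set.range (Function.update y k (x k + x j)))).radical :=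
          ⟨n, hyj ▸ hother j hij⟩
        have h2 : x k + x j ∈
            (Ideal.span (Set.range (Function.update y k (x k + x j)))).radical :=
          Ideal.le_radical (Ideal.subset_span ⟨k, by simp⟩)
        rw [← hy, hyi]
        simpa using sub_mem h2 h1
      · exact Ideal.le_radical (hother k hk)
  have haP : a * x i ∈ Ideal.span (y '' {i}ᶜ) := span_le_span_powOutside x hi n ha
  have hw : a * (x i + x j) ^ n ∈ Ideal.span (y '' {i}ᶜ) := by
    obtain ⟨q, hq⟩ := sub_dvd_pow_sub_pow (x i + x j) (x j) n
    rw [add_sub_cancel_right] at hq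
    have h1 : a * (x i + x j) ^ n = q * (a * x i) + a * x j ^ n := by
      linear_combination a * hq
    rw [h1]
    refine add_mem (Ideal.mul_mem_left _ _ haP) (Ideal.mul_mem_left _ _ ?_)
    rw [← hyj]
    exact Ideal.subset_span ⟨j, hij, rfl⟩
  have h := mul_param_mem_of_mul_pow_mem hB hz i (n := n) (a := a)
  rw [himage] at h
  simp only [Function.update_self] at h
  have h2 := sub_mem (h hw) haP
  convert h2 using 1
  ring

/-- `(Q_J : x_i) ∩ Q = Q_J`, where `Q_J` is generated by the parameters with index in `J`. -/
theorem mem_span_of_mul_param_mem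
    (hB : ∀ Q : Ideal R, IsParameterIdeal Q → lengthInt R (R ⧸ Q) - hilbertCoeff Q 0 = c)
    {x : Fin d → R} (hx : IsSystemOfParameters x) {J : Set (Fin d)} {i : Fin d} (hi : i ∉ J) {a : R}
    (ha : a * x i ∈ Ideal.span (x '' J)) (haQ : a ∈ Ideal.span (Set.range x)) :
    a ∈ Ideal.span (x '' J) := by
  classical
  -- Extra generators are removed one at a time. If `a ≡ r x_l`, then `a x_l ∈ Q_J` gives `r x_l^2 ≡
  -- 0`, hence `r x_l ≡ 0` modulo the remaining generators.
  have key : ∀ K : Finset (Fin d), (∀ k ∈ K, k ∉ J) → a ∈ Ideal.span (x '' (J ∪ K)) →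
      a ∈ Ideal.span (x '' J) := by
    intro K
    induction K using Finset.induction_on with
    | empty => intro _ h; simpa using h
    | insert l K hl ih =>
      intro hK h
      refine ih (fun k hk => hK k (Finset.mem_insert_of_mem hk)) ?_
      have hlJ : l ∉ J := hK l (Finset.mem_insert_self l K)
      rw [Finset.coe_insert, Set.union_insert, span_image_insert] at h
      obtain ⟨r, hr⟩ := mem_sup_span_singleton.mp h
      have h1 : a * x l ∈ Ideal.span (x '' (J ∪ K)) :=
        Ideal.span_mono (Set.image_mono Set.subset_union_left)
          (mul_param_mem_span_of_mul_param_mem hB hx hi hlJ ha)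
      have h2 : r * x l ^ 2 ∈ Ideal.span (x '' (J ∪ K)) := by
        convert sub_mem h1 (Ideal.mul_mem_right (x l) _ hr) using 1
        ring
      have h3 := mul_param_mem_span_of_mul_sq_mem hB hx (J := J ∪ K) (i := l)
        (by simp [hlJ, hl]) h2
      simpa using add_mem hr h3
  refine key (Finset.univ.filter fun k => k ∉ J) (by simp) ?_
  convert haQ
  rw [← Set.image_univ]
  congr 1
  ext k
  simp [em]

theorem colength_colonSup
    (hB : ∀ Q : Ideal R, IsParameterIdeal Q → lengthInt R (R ⧸ Q) - hilbertCoeff Q 0 = c)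
    {x : Fin d → R} (hx : IsSystemOfParameters x) (i : Fin d) :
    colength (colonSup x i) = paramMult x := by
  rw [← colength_colon_pow_sup hB hx i one_pos, pow_one, colonSup, span_range_eq_sup x i,
    ← sup_assoc]
  congr 2
  exact sup_eq_left.mpr fun b hb => mem_colon_singleton_iff_mul_mem.mpr (Ideal.mul_mem_right _ _ hb)

/-- Modulo `Q`, an element of the intersection is represented by one `v` with `v x_i ∈ P + (x_j)`
and `v x_j ∈ P + (x_i)`. The intersection property with `x_j` squared then corrects `v` by a
multiple of `x_j` to an element of `P : x_j`. -/
theorem colonSup_inf_le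
    (hB : ∀ Q : Ideal R, IsParameterIdeal Q → lengthInt R (R ⧸ Q) - hilbertCoeff Q 0 = c)
    {x : Fin d → R} (hx : IsSystemOfParameters x) {i j : Fin d} (hij : i ≠ j) :
    colonSup x i ⊓ colonSup x j ≤
      (Ideal.span (x '' {i, j}ᶜ)).colon {x j} ⊔ Ideal.span (Set.range x) := by
  set P := Ideal.span (x '' {i, j}ᶜ) with hP
  have hPi : Ideal.span (x '' {i}ᶜ) = P ⊔ Ideal.span {x j} := span_image_compl_singleton x hij
  have hPj : Ideal.span (x '' {j}ᶜ) = P ⊔ Ideal.span {x i} := by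
    rw [span_image_compl_singleton x hij.symm, Set.pair_comm]
  have hQ : Ideal.span (Set.range x) = P ⊔ Ideal.span {x j} ⊔ Ideal.span {x i} := by
    rw [span_range_eq_sup x i, hPi]
  rintro u ⟨hu, hu'⟩
  obtain ⟨u₀, hu₀, q₀, hq₀, rfl⟩ := Submodule.mem_sup.mp hu
  obtain ⟨u₁, hu₁, q₁, hq₁, h01⟩ := Submodule.mem_sup.mp hu'
  rw [mem_colon_singleton_iff_mul_mem] at hu₀ hu₁
  have hq : u₀ - u₁ ∈ P ⊔ Ideal.span {x j} ⊔ Ideal.span {x i} := by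
    rw [← hQ]
    convert sub_mem hq₁ hq₀ using 1
    linear_combination -h01
  obtain ⟨t, ht⟩ := mem_sup_span_singleton.mp hq
  obtain ⟨s, hs⟩ := mem_sup_span_singleton.mp ht
  set v := u₀ - s * x j with hv
  have hvi : v * x i ∈ P ⊔ Ideal.span {x j} := by
    rw [← hPi, hv, sub_mul]
    refine sub_mem hu₀ (Ideal.mul_mem_right _ _ (Ideal.mul_mem_left _ _ ?_))
    exact Ideal.subset_span ⟨j, hij.symm, rfl⟩
  have hvj : v * x j ∈ P ⊔ Ideal.span {x i} := by
    rw [← hPj]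
    have h1 : v * x j = u₁ * x j + (u₀ - u₁ - t * x i - s * x j) * x j + t * x i * x j := by
      rw [hv]; ring
    rw [h1]
    refine add_mem (add_mem hu₁ (Ideal.mul_mem_right _ _ ?_)) (Ideal.mul_mem_right _ _
      (Ideal.mul_mem_left _ _ (Ideal.subset_span ⟨i, hij, rfl⟩)))
    rw [hPj]
    exact Ideal.mem_sup_left hs
  have hy := hx.update_pow j two_pos
  have hyimage : Ideal.span (Function.update x j (x j ^ 2) '' {i}ᶜ) =
      P ⊔ Ideal.span {x j ^ 2} := by
    rw [span_image_compl_singleton _ hij, Function.update_self]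
    congr 2
    refine Set.image_congr fun k hk => Function.update_of_ne ?_ _ _
    rintro rfl
    simp at hk
  -- Here `v x_j x_i ∈ P + (x_j^2)`, while `v x_j` lies in the parameter ideal `P + (x_j^2, x_i)`.
  have hb : v * x j ∈ P ⊔ Ideal.span {x j ^ 2} := by
    rw [← hyimage]
    refine mem_span_of_mul_param_mem hB hy (i := i) (by simp) ?_ ?_
    · rw [hyimage, Function.update_of_ne hij]
      obtain ⟨r, hr⟩ := mem_sup_span_singleton.mp hvi
      refine mem_sup_span_singleton.mpr ⟨r, ?_⟩
      convert Ideal.mul_mem_right (x j) _ hr using 1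
      ring
    · rw [span_range_eq_sup _ i, hyimage, Function.update_of_ne hij]
      exact (sup_le_sup_right le_sup_left _ : P ⊔ Ideal.span {x i} ≤
        P ⊔ Ideal.span {x j ^ 2} ⊔ Ideal.span {x i}) hvj
  obtain ⟨r, hr⟩ := mem_sup_span_singleton.mp hb
  have hfin : u₀ + q₀ = (v - r * x j) + ((r + s) * x j + q₀) := by rw [hv]; ring
  rw [hfin]
  refine Submodule.add_mem_sup ?_ (add_mem (Ideal.mul_mem_left _ _ (Ideal.subset_span ⟨j, rfl⟩)) hq₀)
  rw [mem_colon_singleton_iff_mul_mem]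
  convert hr using 1
  ring

theorem colength_colonSup_sup_le
    (hB : ∀ Q : Ideal R, IsParameterIdeal Q → lengthInt R (R ⧸ Q) - hilbertCoeff Q 0 = c)
    {D : ℕ} {x : Fin (D + 2) → R} (hx : IsSystemOfParameters x) :
    colength (colonSup x 0 ⊔ colonSup x 1) ≤ hilbertCoeff (Ideal.span (Set.range x)) 0 +
      hilbertCoeff (Ideal.span (Set.range x)) 1 := by
  have s0 : ({0}ᶜ : Set (Fin (D + 2))) = {j | 0 < j} := by
    ext j; simp [Fin.pos_iff_ne_zero]
  have s1 : ({0, 1}ᶜ : Set (Fin (D + 2))) = {j | 1 < j} := by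
    ext j
    simp only [Set.mem_compl_iff, Set.mem_insert_iff, Set.mem_singleton_iff, Set.mem_ofPred_eq,
      Fin.ext_iff, Fin.lt_def, Fin.val_zero, Fin.val_one]
    omega
  have h0 := colength_colonSup hB hx 0
  have h1 := colength_colonSup hB hx 1
  have hfin : Module.length R (R ⧸ (colonSup x 0 ⊓ colonSup x 1)) ≠ ⊤ :=
    length_quotient_ne_top_of_le hx.length_quotient_ne_top (le_inf le_sup_right le_sup_right)
  have h2 := colength_mono hfin (colonSup_inf_le hB hx (i := 0) (j := 1) (by simp))
  have h3 := colength_inf_add_colength_sup hfin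
  have h4 := hx.le_hilbertCoeff_one (by rw [← s0]; exact h0)
  rw [s1] at h2
  rw [paramMult] at h0 h1
  linarith

end BuchsbaumColon

/-! ### Regularity and membership after squaring some parameters -/

section SquaredParameters

variable {R : Type*} [CommRing R] {d : ℕ}

/-- Replace the elements with index in `E` by their squares. -/
def squareOn (x : Fin d → R) (E : Finset (Fin d)) : Fin d → R := fun j =>
  if j ∈ E then x j ^ 2 else x j

theorem squareOn_empty (x : Fin d → R) : squareOn x ∅ = x := by
  funext j
  simp [squareOn]

theorem squareOn_insert_of_ne (x : Fin d → R) (E : Finset (Fin d)) {l j : Fin d} (h : j ≠ l) :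
    squareOn x (insert l E) j = squareOn x E j := by
  simp [squareOn, h]

theorem span_squareOn_insert (x : Fin d → R) {E J : Finset (Fin d)} {l : Fin d} (hl : l ∈ J) :
    Ideal.span (squareOn x (insert l E) '' J) =
      Ideal.span (squareOn x E '' (J.erase l)) ⊔ Ideal.span {x l ^ 2} := by
  conv_lhs => rw [← Finset.insert_erase hl, Finset.coe_insert, span_image_insert]
  congr 2
  · refine Set.image_congr fun k hk => squareOn_insert_of_ne x E ?_
    exact (Finset.mem_erase.mp hk).1
  · simp [squareOn]

theorem span_squareOn_eq_sup (x : Fin d → R) {E J : Finset (Fin d)} {l : Fin d} (hl : l ∈ J)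
    (hE : l ∉ E) : Ideal.span (squareOn x E '' J) =
      Ideal.span (squareOn x E '' (J.erase l)) ⊔ Ideal.span {x l} := by
  conv_lhs => rw [← Finset.insert_erase hl, Finset.coe_insert, span_image_insert]
  simp [squareOn, hE]

/-- If each `x i` is regular modulo every set of fewer than `k` others, then the same holds when some
of these others are squared. -/
theorem mem_span_squareOn_of_mul_mem {x : Fin d → R} {k : ℕ}
    (hreg : ∀ J : Finset (Fin d), J.card < k → ∀ i ∉ J, ∀ a, a * x i ∈ Ideal.span (x '' J) →
      a ∈ Ideal.span (x '' J)) (E : Finset (Fin d)) :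
    ∀ J : Finset (Fin d), J.card < k → ∀ i ∉ J, ∀ a, a * x i ∈ Ideal.span (squareOn x E '' J) →
      a ∈ Ideal.span (squareOn x E '' J) := by
  induction E using Finset.induction_on with
  | empty => simpa only [squareOn_empty] using hreg
  | insert l E hE ih =>
    intro J hJ i hi a ha
    by_cases hl : l ∈ J
    · have hJ' : (J.erase l).card < k := (Finset.card_erase_lt_of_mem hl).trans hJ
      have hJl := span_squareOn_eq_sup x hl hE
      have ih1 := ih J hJ i hi
      have ih2 := ih (J.erase l) hJ' l (Finset.notMem_erase l J)
      rw [hJl] at ih1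
      rw [span_squareOn_insert x hl] at ha ⊢
      set K := Ideal.span (squareOn x E '' (J.erase l))
      -- Modulo `K`: `a x_i = r x_l^2` gives `a = b x_l`. Cancelling `x_l` gives `b x_i = r x_l`, so
      -- `b` is a multiple of `x_l` and `a` one of `x_l^2`.
      obtain ⟨r, hr⟩ := mem_sup_span_singleton.mp ha
      obtain ⟨b, hb⟩ := mem_sup_span_singleton.mp (ih1 a (mem_sup_span_singleton.mpr ⟨r * x l, by
        convert hr using 1; ring⟩))
      have h1 : b * x i - r * x l ∈ K := by
        refine ih2 _ ?_
        convert sub_mem hr (Ideal.mul_mem_right (x i) _ hb) using 1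
        ring
      obtain ⟨s, hs⟩ := mem_sup_span_singleton.mp (ih1 b (mem_sup_span_singleton.mpr ⟨r, h1⟩))
      refine mem_sup_span_singleton.mpr ⟨s, ?_⟩
      convert add_mem hb (Ideal.mul_mem_right (x l) _ hs) using 1
      ring
    · have himage : squareOn x (insert l E) '' J = squareOn x E '' J :=
        Set.image_congr fun j hj => squareOn_insert_of_ne x E (by rintro rfl; exact hl hj)
      rw [himage] at ha ⊢
      exact ih J hJ i hi a ha

/-- One factor `x_l` is cancelled at a time: `a x_l ≡ r x_l^2` modulo the other generators, where
`x_l` is regular, so `a ≡ r x_l`. -/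
theorem mem_span_of_mul_prod_mem {x : Fin d → R} {k : ℕ}
    (hreg : ∀ J : Finset (Fin d), J.card < k → ∀ i ∉ J, ∀ a, a * x i ∈ Ideal.span (x '' J) →
      a ∈ Ideal.span (x '' J)) {J : Finset (Fin d)} (hJ : J.card ≤ k) {E : Finset (Fin d)}
    (hE : E ⊆ J) {a : R} (ha : a * ∏ l ∈ E, x l ∈ Ideal.span (squareOn x E '' J)) :
    a ∈ Ideal.span (x '' J) := by
  induction E using Finset.induction_on with
  | empty => simpa [squareOn_empty] using ha
  | insert l E hl ih =>
    have hlJ : l ∈ J := hE (Finset.mem_insert_self l E)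
    refine ih ((Finset.subset_insert l E).trans hE) ?_
    rw [Finset.prod_insert hl, span_squareOn_insert x hlJ] at ha
    rw [span_squareOn_eq_sup x hlJ hl]
    obtain ⟨r, hr⟩ := mem_sup_span_singleton.mp ha
    refine mem_sup_span_singleton.mpr ⟨r, ?_⟩
    refine mem_span_squareOn_of_mul_mem hreg E (J.erase l)
      ((Finset.card_erase_lt_of_mem hlJ).trans_le hJ) l (Finset.notMem_erase l J) _ ?_
    convert hr using 1
    ring

theorem mul_prod_mem_of_mem_span (x : Fin d → R) {J : Finset (Fin d)} {S T : Finset (Fin d)}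
    (hST : ∀ m ∈ S, m ∈ J → m ∈ T) {b : R} (hb : b ∈ Ideal.span (x '' S)) :
    b * ∏ l ∈ T, x l ∈ Ideal.span (squareOn x J '' S) := by
  refine Submodule.span_induction (p := fun b _ => b * ∏ l ∈ T, x l ∈
    Ideal.span (squareOn x J '' S)) ?_ ?_ ?_ ?_ hb
  · rintro _ ⟨m, hm, rfl⟩
    have hmem : squareOn x J m ∈ Ideal.span (squareOn x J '' S) := Ideal.subset_span ⟨m, hm, rfl⟩
    by_cases hmJ : m ∈ J
    · rw [← Finset.mul_prod_erase _ _ (hST m hm hmJ), ← mul_assoc, ← pow_two]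
      refine Ideal.mul_mem_right _ _ ?_
      simpa [squareOn, hmJ] using hmem
    · refine Ideal.mul_mem_right _ _ ?_
      simpa [squareOn, hmJ] using hmem
  · simp
  · intro b b' _ _ hb hb'
    rw [add_mul]
    exact add_mem hb hb'
  · intro r b _ hb
    rw [smul_eq_mul, mul_assoc]
    exact Ideal.mul_mem_left _ _ hb

theorem mul_prod_mem_of_mem_colonSup (x : Fin d → R) {J : Finset (Fin d)} {j : Fin d} (hj : j ∈ J)
    {a : R} (ha : a ∈ colonSup x j) :
    a * ∏ l ∈ J, x l ∈ Ideal.span (Set.range (squareOn x J)) := by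
  obtain ⟨u, hu, q, hq, rfl⟩ := Submodule.mem_sup.mp ha
  rw [mem_colon_singleton_iff_mul_mem] at hu
  rw [add_mul]
  refine add_mem ?_ ?_
  · rw [← Finset.mul_prod_erase _ _ hj, ← mul_assoc]
    have h := mul_prod_mem_of_mem_span x (J := J) (S := Finset.univ.erase j) (T := J.erase j)
      (b := u * x j) (fun m hm hmJ => Finset.mem_erase.mpr ⟨(Finset.mem_erase.mp hm).1, hmJ⟩)
      (by rwa [show ((Finset.univ.erase j : Finset (Fin d)) : Set (Fin d)) = {j}ᶜ by ext; simp])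
    exact Ideal.span_mono (Set.image_subset_range _ _) h
  · have h := mul_prod_mem_of_mem_span x (J := J) (S := Finset.univ) (T := J)
      (b := q) (fun m _ hmJ => hmJ) (by simpa using hq)
    simpa using h

end SquaredParameters

/-! ### The case of equality -/

section Equality

variable {R : Type*} [CommRing R] {d : ℕ}

theorem colonSup_comp_perm (x : Fin d → R) (σ : Equiv.Perm (Fin d)) (i : Fin d) :
    colonSup (x ∘ σ) i = colonSup x (σ i) := by
  rw [colonSup, colonSup, σ.surjective.range_comp, Set.image_comp, Equiv.image_compl,
    Set.image_singleton, Function.comp_apply]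

variable [IsLocalRing R]

theorem IsSystemOfParameters.comp_perm {x : Fin d → R} (hx : IsSystemOfParameters x)
    (σ : Equiv.Perm (Fin d)) : IsSystemOfParameters (x ∘ σ) := by
  rw [IsSystemOfParameters, σ.surjective.range_comp]
  exact hx

variable [IsNoetherianRing R] {c : ℤ}

/-- After a permutation, the length estimate bounds the colength of `C_i + C_j ⊆ Q^lim` by that of
`Q^lim`, so the two ideals coincide. -/
theorem limitClosure_le_colonSup_sup
    (hB : ∀ Q : Ideal R, IsParameterIdeal Q → lengthInt R (R ⧸ Q) - hilbertCoeff Q 0 = c)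
    {D : ℕ} {x : Fin (D + 2) → R} (hx : IsSystemOfParameters x)
    (heq : hilbertCoeff (Ideal.span (Set.range x)) 0 + hilbertCoeff (Ideal.span (Set.range x)) 1 =
      colength (limitClosure x)) {i j : Fin (D + 2)} (hij : i ≠ j) :
    limitClosure x ≤ colonSup x i ⊔ colonSup x j := by
  obtain ⟨σ, h0, h1⟩ : ∃ σ : Equiv.Perm (Fin (D + 2)), σ 0 = i ∧ σ 1 = j := by
    -- The first swap sends `0` to `i`; the second moves the image of `1` to `j` and fixes `i`.
    refine ⟨Equiv.swap (Equiv.swap 0 i 1) j * Equiv.swap 0 i, ?_, ?_⟩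
    · rw [Equiv.Perm.mul_apply, Equiv.swap_apply_left, Equiv.swap_apply_of_ne_of_ne _ hij]
      intro h
      have := (Equiv.swap (0 : Fin (D + 2)) i).injective
        ((Equiv.swap_apply_left (0 : Fin (D + 2)) i).trans h)
      simp at this
    · rw [Equiv.Perm.mul_apply, Equiv.swap_apply_left]
  have hle := colength_colonSup_sup_le hB (hx.comp_perm σ)
  rw [σ.surjective.range_comp, heq, colonSup_comp_perm, colonSup_comp_perm, h0, h1] at hle
  have hsub : colonSup x i ⊔ colonSup x j ≤ limitClosure x :=
    sup_le (colonSup_le_limitClosure x i) (colonSup_le_limitClosure x j)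
  refine (eq_of_colength_le ?_ hsub hle).ge
  exact length_quotient_ne_top_of_le hx.length_quotient_ne_top (le_sup_of_le_left le_sup_right)

/-- Regularity modulo at most one parameter and equality in the bound for the limit closure imply
that the parameters form a regular sequence in any order. -/
theorem mem_span_of_mul_param_mem_of_limitClosure_le
    (hB : ∀ Q : Ideal R, IsParameterIdeal Q → lengthInt R (R ⧸ Q) - hilbertCoeff Q 0 = c)
    {x : Fin d → R} (hx : IsSystemOfParameters x)
    (hlim : ∀ i j, i ≠ j → limitClosure x ≤ colonSup x i ⊔ colonSup x j)
    (hreg : ∀ J : Finset (Fin d), J.card < 2 → ∀ i ∉ J, ∀ a, a * x i ∈ Ideal.span (x '' J) →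
      a ∈ Ideal.span (x '' J)) (k : ℕ) :
    ∀ J : Finset (Fin d), J.card < k → ∀ i ∉ J, ∀ a, a * x i ∈ Ideal.span (x '' J) →
      a ∈ Ideal.span (x '' J) := by
  induction k with
  | zero => simp
  | succ k ih =>
    intro J hJ i hi a ha
    by_cases hcard : J.card < 2
    · exact hreg J hcard i hi a ha
    obtain ⟨j, hj, l, hl, hjl⟩ := Finset.one_lt_card.mp (by omega : 1 < J.card)
    have hlim' := hlim j l hjl (mem_limitClosure_of_mul_param_mem x (J := (J : Set (Fin d))) hi ha)
    obtain ⟨u, hu, v, hv, huv⟩ := Submodule.mem_sup.mp hlim'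
    have hmem : a * ∏ m ∈ J, x m ∈ Ideal.span (Set.range (squareOn x J)) := by
      rw [← huv, add_mul]
      exact add_mem (mul_prod_mem_of_mem_colonSup x hj hu) (mul_prod_mem_of_mem_colonSup x hl hv)
    have hsq : IsSystemOfParameters (squareOn x J) := by
      have h := hx.pow (m := fun j => if j ∈ J then 2 else 1) fun j => by split_ifs <;> omega
      convert h using 1
      funext j
      simp only [squareOn]
      split_ifs <;> simp
    -- The induction hypothesis cancels the product, once the product lies in the ideal of the
    -- squares with index in `J` alone. The intersection property for the squared system provides
    -- this, since `hmem` puts it in the whole parameter ideal.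
    refine mem_span_of_mul_prod_mem ih (by omega) (Finset.Subset.refl J) ?_
    refine mem_span_of_mul_param_mem hB hsq (J := (J : Set (Fin d))) (i := i) hi ?_ hmem
    have h := mul_prod_mem_of_mem_span x (J := J) (S := J) (T := J) (fun _ _ h => h) ha
    convert h using 1
    simp only [squareOn, hi, if_false]
    ring

end Equality

/-! ### Consequences of Serre's condition -/

section Depth

theorem exists_regular_of_one_le_localDepth {S : Type*} [CommRing S] [IsLocalRing S]
    (h : 1 ≤ localDepth S) :
    ∃ r ∈ IsLocalRing.maximalIdeal S, ∀ a, a * r = 0 → a = 0 := by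
  obtain ⟨rs, ⟨hm, hreg⟩, hlen⟩ : ∃ rs ∈ {rs : List S | (∀ r ∈ rs, r ∈ IsLocalRing.maximalIdeal S) ∧
      RingTheory.Sequence.IsRegular S rs}, (0 : ℕ∞) < rs.length := by
    have := lt_of_lt_of_le (zero_lt_one' ℕ∞) h
    simpa [localDepth, lt_iSup_iff] using this
  match rs, hm, hreg, hlen with
  | r :: l, hm, hreg, _ =>
    refine ⟨r, hm r (by simp), fun a ha => ?_⟩
    have h1 := ((RingTheory.Sequence.isWeaklyRegular_cons_iff S r l).mp hreg.toIsWeaklyRegular).1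
    exact h1 (by simpa [mul_comm] using ha)

theorem exists_regular_of_two_le_localDepth {S : Type*} [CommRing S] [IsLocalRing S]
    (h : 2 ≤ localDepth S) :
    ∃ r ∈ IsLocalRing.maximalIdeal S, ∃ s ∈ IsLocalRing.maximalIdeal S, (∀ a, a * r = 0 → a = 0) ∧
      ∀ a, r ∣ a * s → r ∣ a := by
  obtain ⟨rs, ⟨hm, hreg⟩, hlen⟩ : ∃ rs ∈ {rs : List S | (∀ r ∈ rs, r ∈ IsLocalRing.maximalIdeal S) ∧
      RingTheory.Sequence.IsRegular S rs}, (1 : ℕ∞) < rs.length := by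
    have := lt_of_lt_of_le (show (1 : ℕ∞) < 2 by norm_num) h
    simpa only [localDepth, lt_iSup_iff, exists_prop] using this
  match rs, hm, hreg, hlen with
  | [_], _, _, hlen => simp at hlen
  | r :: s :: l, hm, hreg, _ =>
    refine ⟨r, hm r (by simp), s, hm s (by simp), fun a ha => ?_, fun a ha => ?_⟩
    · have h1 := ((RingTheory.Sequence.isWeaklyRegular_cons_iff S r _).mp
        hreg.toIsWeaklyRegular).1
      exact h1 (by simpa [mul_comm] using ha)
    · have h1 := hreg.regular_mod_prev 1 (by simp)
      simp only [List.take_succ_cons, List.take_zero, List.getElem_cons_succ,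
        List.getElem_cons_zero] at h1
      have h2 := mem_of_isSMulRegular_quotient_of_smul_mem (x := a) h1
      simp only [Ideal.ofList_singleton, smul_eq_mul, Ideal.mul_top, Ideal.mem_span_singleton] at h2
      exact h2 (by rwa [mul_comm])

variable {R : Type*} [CommRing R]

theorem dvd_of_dvd_mul_pow {r s : R} (hr : ∀ a, a * r = 0 → a = 0) (hs : ∀ a, r ∣ a * s → r ∣ a)
    (k n : ℕ) {a : R} (h : r ^ n ∣ a * s ^ k) : r ^ n ∣ a := by
  have hs' : ∀ k a, r ∣ a * s ^ k → r ∣ a := by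
    intro k
    induction k with
    | zero => intro a h; simpa using h
    | succ k ih => intro a h; exact ih a (hs _ (by rwa [mul_assoc, ← pow_succ]))
  have hrn : ∀ n a, a * r ^ n = 0 → a = 0 := by
    intro n
    induction n with
    | zero => intro a h; simpa using h
    | succ n ih => intro a h; exact ih a (hr _ (by rwa [mul_assoc, ← pow_succ]))
  induction n generalizing a with
  | zero => simp
  | succ n ih =>
    obtain ⟨b, rfl⟩ := ih ((pow_dvd_pow r n.le_succ).trans h)
    obtain ⟨q, hq⟩ := h
    have h1 : b * s ^ k - r * q = 0 := hrn n _ (by linear_combination hq)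
    obtain ⟨q', hq'⟩ := hs' k b ⟨q, by linear_combination h1⟩
    exact ⟨q', by rw [hq']; ring⟩

variable [IsLocalRing R]

/-- Serre's condition enters the proof only here, at the maximal ideal. -/
theorem SatisfiesSerreS.localDepth_localization (hS2 : SatisfiesSerreS R 2) :
    min (2 : WithBot ℕ∞) (ringKrullDim R) ≤
      localDepth (Localization.AtPrime (IsLocalRing.maximalIdeal R)) := by
  have h := hS2 (IsLocalRing.maximalIdeal R)
  rw [IsLocalization.AtPrime.ringKrullDim_eq_height (IsLocalRing.maximalIdeal R),
    IsLocalRing.maximalIdeal_height_eq_ringKrullDim] at h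
  exact_mod_cast h

/-- A local ring is its own localization at the maximal ideal. -/
noncomputable def localizationEquiv (R : Type*) [CommRing R] [IsLocalRing R] :
    R ≃+* Localization.AtPrime (IsLocalRing.maximalIdeal R) :=
  (IsLocalization.atUnits R (IsLocalRing.maximalIdeal R).primeCompl fun a ha => by
    simpa [IsUnit.mem_submonoid_iff, Ideal.mem_primeCompl_iff] using ha).toRingEquiv

theorem exists_regular_of_satisfiesSerreS_of_one_le (hS2 : SatisfiesSerreS R 2)
    (hd : 1 ≤ ringKrullDim R) :
    ∃ r ∈ IsLocalRing.maximalIdeal R, ∀ a, a * r = 0 → a = 0 := by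
  have h := hS2.localDepth_localization
  have h1 : (1 : ℕ∞) ≤ localDepth (Localization.AtPrime (IsLocalRing.maximalIdeal R)) := by
    have : (1 : WithBot ℕ∞) ≤ localDepth (Localization.AtPrime (IsLocalRing.maximalIdeal R)) :=
      (le_min (by norm_num) hd).trans h
    exact_mod_cast this
  obtain ⟨r, hr, hreg⟩ := exists_regular_of_one_le_localDepth h1
  let e := localizationEquiv R
  refine ⟨e.symm r, ?_, fun a ha => ?_⟩
  · simpa [IsLocalRing.mem_maximalIdeal] using hr
  · have : e a * r = 0 := by simpa using congrArg e ha
    simpa using hreg _ this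

theorem exists_regular_of_satisfiesSerreS_of_two_le (hS2 : SatisfiesSerreS R 2)
    (hd : 2 ≤ ringKrullDim R) :
    ∃ r ∈ IsLocalRing.maximalIdeal R, ∃ s ∈ IsLocalRing.maximalIdeal R, (∀ a, a * r = 0 → a = 0) ∧
      ∀ a, r ∣ a * s → r ∣ a := by
  have h := hS2.localDepth_localization
  have h1 : (2 : ℕ∞) ≤ localDepth (Localization.AtPrime (IsLocalRing.maximalIdeal R)) := by
    have : (2 : WithBot ℕ∞) ≤ localDepth (Localization.AtPrime (IsLocalRing.maximalIdeal R)) :=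
      (le_min le_rfl hd).trans h
    exact WithBot.coe_le_coe.mp this
  obtain ⟨r, hr, s, hs, hreg, hreg'⟩ := exists_regular_of_two_le_localDepth h1
  let e := localizationEquiv R
  refine ⟨e.symm r, ?_, e.symm s, ?_, fun a ha => ?_, fun a ha => ?_⟩
  · simpa [IsLocalRing.mem_maximalIdeal] using hr
  · simpa [IsLocalRing.mem_maximalIdeal] using hs
  · have : e a * r = 0 := by simpa using congrArg e ha
    simpa using hreg _ this
  · have : r ∣ e a * s := by simpa using map_dvd e ha
    simpa using map_dvd e.symm (hreg' _ this)

theorem eq_zero_of_mul_pow_maximalIdeal {r : R} (hrm : r ∈ IsLocalRing.maximalIdeal R)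
    (hr : ∀ a, a * r = 0 → a = 0) {a : R} {N : ℕ}
    (h : ∀ b ∈ IsLocalRing.maximalIdeal R ^ N, a * b = 0) : a = 0 := by
  have hpow := h _ (Ideal.pow_mem_pow hrm N)
  clear h
  induction N with
  | zero => simpa using hpow
  | succ N ih => exact ih (hr _ (by rwa [mul_assoc, ← pow_succ]))

/-- Depth two excludes torsion modulo a regular `y`. From `a r^N = y b` and `a s^N = y b'` follows
`b s^N = b' r^N`. Hence `r^N` divides `b`, and cancelling it shows that `y` divides `a`. -/
theorem dvd_of_dvd_mul_pow_maximalIdeal {r s : R} (hrm : r ∈ IsLocalRing.maximalIdeal R)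
    (hsm : s ∈ IsLocalRing.maximalIdeal R) (hr : ∀ a, a * r = 0 → a = 0)
    (hs : ∀ a, r ∣ a * s → r ∣ a) {y : R} (hy : ∀ a, a * y = 0 → a = 0) {a : R} {N : ℕ}
    (h : ∀ b ∈ IsLocalRing.maximalIdeal R ^ N, y ∣ a * b) : y ∣ a := by
  obtain ⟨b, hb⟩ := h _ (Ideal.pow_mem_pow hrm N)
  obtain ⟨b', hb'⟩ := h _ (Ideal.pow_mem_pow hsm N)
  have h1 : b * s ^ N - b' * r ^ N = 0 := hy _ (by linear_combination r ^ N * hb' - s ^ N * hb)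
  obtain ⟨q, rfl⟩ := dvd_of_dvd_mul_pow hr hs N N (a := b) ⟨b', by linear_combination h1⟩
  have hrN : ∀ c, c * r ^ N = 0 → c = 0 := by
    clear * - hr
    induction N with
    | zero => intro c h; simpa using h
    | succ N ih => intro c h; exact ih c (hr _ (by rwa [mul_assoc, ← pow_succ]))
  have h2 : a - y * q = 0 := hrN _ (by linear_combination hb)
  exact ⟨q, by linear_combination h2⟩

end Depth

/-! ### The Cohen–Macaulay criterion and small dimensions -/

section CohenMacaulay

variable {R : Type*} [CommRing R] [IsLocalRing R] [IsNoetherianRing R] {d : ℕ} {c : ℤ}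

theorem localDepth_le_ringKrullDim : (localDepth R : WithBot ℕ∞) ≤ ringKrullDim R := by
  obtain ⟨n, hn⟩ : ∃ n : ℕ∞, ringKrullDim R = n := by
    cases h : ringKrullDim R with
    | bot => exact absurd h ringKrullDim_ne_bot
    | coe n => exact ⟨n, rfl⟩
  rw [hn, WithBot.coe_le_coe]
  refine iSup₂_le fun rs hrs => ?_
  have h := ringKrullDim_add_length_eq_ringKrullDim_of_isRegular rs hrs.2
  have hnt : Nontrivial (R ⧸ Ideal.ofList rs) := by
    refine Ideal.Quotient.nontrivial_iff.mpr fun htop => hrs.2.top_ne_smul ?_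
    rw [htop]
    simp
  have h0 : 0 ≤ ringKrullDim (R ⧸ Ideal.ofList rs) := ringKrullDim_nonneg_of_nontrivial
  rw [hn] at h
  have h1 : ((rs.length : ℕ∞) : WithBot ℕ∞) ≤ (n : WithBot ℕ∞) := by
    rw [← h]
    exact le_add_of_nonneg_left h0
  exact WithBot.coe_le_coe.mp h1

theorem isCohenMacaulayLocal_of_forall_mem {x : Fin d → R} (hx : IsSystemOfParameters x)
    (hreg : ∀ J : Finset (Fin d), ∀ i ∉ J, ∀ a, a * x i ∈ Ideal.span (x '' J) →
      a ∈ Ideal.span (x '' J)) : IsCohenMacaulayLocal R := by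
  have hm : ∀ r ∈ List.ofFn x, r ∈ IsLocalRing.maximalIdeal R := by
    intro r hr
    obtain ⟨i, rfl⟩ := (List.mem_ofFn' x r).mp hr
    exact hx.mem_maximalIdeal i
  have hw : RingTheory.Sequence.IsWeaklyRegular R (List.ofFn x) := by
    refine ⟨fun i hi => ?_⟩
    have hi' : i < d := by simpa using hi
    have hspan : Ideal.ofList ((List.ofFn x).take i) • (⊤ : Submodule R R) =
        Ideal.span (x '' (Finset.univ.filter fun j : Fin d => (j : ℕ) < i : Finset (Fin d))) := by
      rw [smul_eq_mul, Ideal.mul_top, Ideal.ofList]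
      congr 1
      ext r
      simp only [List.mem_take_iff_getElem, Set.mem_ofPred_eq, List.getElem_ofFn, List.length_ofFn,
        Set.mem_image, Finset.coe_filter, Finset.mem_univ, true_and]
      constructor
      · rintro ⟨j, hj, rfl⟩
        exact ⟨⟨j, by omega⟩, by simpa using lt_of_lt_of_le hj (min_le_left _ _), rfl⟩
      · rintro ⟨j, hj, rfl⟩
        exact ⟨j, lt_min hj j.2, rfl⟩
    rw [hspan, List.getElem_ofFn, isSMulRegular_quotient_iff_mem_of_smul_mem]
    intro a ha
    refine hreg _ ⟨i, hi'⟩ (by simp) a ?_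
    rwa [mul_comm, ← smul_eq_mul]
  have hr : RingTheory.Sequence.IsRegular R (List.ofFn x) :=
    RingTheory.Sequence.IsRegular.of_isWeaklyRegular_of_mem_maximalIdeal R hm hw
  refine le_antisymm localDepth_le_ringKrullDim ?_
  rw [hx.1]
  have h : ((List.ofFn x).length : ℕ∞) ≤ localDepth R :=
    le_iSup₂_of_le (f := fun (rs : List R) (_ : rs ∈ {rs : List R |
      (∀ r ∈ rs, r ∈ IsLocalRing.maximalIdeal R) ∧ RingTheory.Sequence.IsRegular R rs}) =>
        (rs.length : ℕ∞)) _ ⟨hm, hr⟩ le_rfl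
  rw [List.length_ofFn] at h
  exact WithBot.coe_le_coe.mpr h

/-- All parameters outside `J` have the same colon, so the whole ideal `Q` multiplies `a` into
`Q_J`, and `Q` contains a power of the maximal ideal. -/
theorem exists_forall_mul_mem_of_mul_param_mem
    (hB : ∀ Q : Ideal R, IsParameterIdeal Q → lengthInt R (R ⧸ Q) - hilbertCoeff Q 0 = c)
    {x : Fin d → R} (hx : IsSystemOfParameters x) {J : Set (Fin d)} {i : Fin d} (hi : i ∉ J) {a : R}
    (ha : a * x i ∈ Ideal.span (x '' J)) :
    ∃ N, ∀ b ∈ IsLocalRing.maximalIdeal R ^ N, a * b ∈ Ideal.span (x '' J) := by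
  obtain ⟨N, hN⟩ := hx.exists_pow_le
  refine ⟨N, fun b hb => ?_⟩
  have hle : Ideal.span (Set.range x) ≤ (Ideal.span (x '' J)).colon {a} := by
    rw [Ideal.span_le]
    rintro _ ⟨j, rfl⟩
    rw [SetLike.mem_coe, mem_colon_singleton_iff_mul_mem, mul_comm]
    by_cases hj : j ∈ J
    · exact Ideal.mul_mem_left _ _ (Ideal.subset_span ⟨j, hj, rfl⟩)
    · exact mul_param_mem_span_of_mul_param_mem hB hx hi hj ha
  rw [mul_comm]
  exact mem_colon_singleton_iff_mul_mem.mp (hle (hN hb))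

theorem eq_zero_of_mul_param_eq_zero
    (hB : ∀ Q : Ideal R, IsParameterIdeal Q → lengthInt R (R ⧸ Q) - hilbertCoeff Q 0 = c)
    {x : Fin d → R} (hx : IsSystemOfParameters x) {r : R}
    (hrm : r ∈ IsLocalRing.maximalIdeal R) (hr : ∀ a, a * r = 0 → a = 0) (i : Fin d) {a : R}
    (ha : a * x i = 0) : a = 0 := by
  obtain ⟨N, hN⟩ := exists_forall_mul_mem_of_mul_param_mem hB hx (J := ∅) (i := i) (by simp)
    (a := a) (by simp [ha])
  exact eq_zero_of_mul_pow_maximalIdeal hrm hr (N := N) fun b hb => by simpa using hN b hb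

theorem mem_span_of_card_lt_two
    (hB : ∀ Q : Ideal R, IsParameterIdeal Q → lengthInt R (R ⧸ Q) - hilbertCoeff Q 0 = c)
    {x : Fin d → R} (hx : IsSystemOfParameters x) {r s : R}
    (hrm : r ∈ IsLocalRing.maximalIdeal R) (hsm : s ∈ IsLocalRing.maximalIdeal R)
    (hr : ∀ a, a * r = 0 → a = 0) (hs : ∀ a, r ∣ a * s → r ∣ a) :
    ∀ J : Finset (Fin d), J.card < 2 → ∀ i ∉ J, ∀ a, a * x i ∈ Ideal.span (x '' J) →
      a ∈ Ideal.span (x '' J) := by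
  intro J hJ i hi a ha
  have hcard : J.card = 0 ∨ J.card = 1 := by omega
  rcases hcard with h | h
  · obtain rfl := Finset.card_eq_zero.mp h
    simp only [Finset.coe_empty, Set.image_empty, Ideal.span_empty, Ideal.mem_bot] at ha ⊢
    exact eq_zero_of_mul_param_eq_zero hB hx hrm hr i ha
  · obtain ⟨j, rfl⟩ := Finset.card_eq_one.mp h
    obtain ⟨N, hN⟩ := exists_forall_mul_mem_of_mul_param_mem hB hx
      (J := (({j} : Finset (Fin d)) : Set (Fin d))) (i := i) hi ha
    simp only [Finset.coe_singleton, Set.image_singleton, Ideal.mem_span_singleton] at hN ⊢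
    exact dvd_of_dvd_mul_pow_maximalIdeal hrm hsm hr hs
      (fun b hb => eq_zero_of_mul_param_eq_zero hB hx hrm hr j hb) hN

theorem hilbertCoeff_sub_colength_limitClosure_of_dim_zero {x : Fin 0 → R}
    (hx : IsSystemOfParameters x) :
    hilbertCoeff (Ideal.span (Set.range x)) 0 - colength (limitClosure x) +
      hilbertCoeff (Ideal.span (Set.range x)) 1 = 0 := by
  have hQ : Ideal.span (Set.range x) = ⊥ := by simp
  have hlim : limitClosure x = ⊥ := by
    rw [eq_bot_iff]
    rintro a ⟨n, hn⟩
    simpa using hn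
  obtain ⟨n, hn⟩ := hx.eventually_colength_eq.exists
  obtain ⟨d, hd, he, -⟩ := hx.isHilbertCoeffs
  have hd0 : d = 0 := by
    have := hd.symm.trans hx.1
    exact_mod_cast this
  -- In dimension zero the coefficient `e_1` is zero by convention.
  have he1 := he 1 (by omega)
  rw [hQ] at hn he1 ⊢
  rw [Ideal.bot_pow n.succ_ne_zero] at hn
  simp only [zero_add, Finset.range_one, Finset.sum_singleton, pow_zero, one_mul, Nat.sub_zero,
    add_zero, Nat.choose_zero_right, Nat.cast_one, mul_one] at hn
  rw [he1, hlim, hn]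
  ring

theorem hilbertCoeff_sub_colength_limitClosure_of_dim_one {x : Fin 1 → R}
    (hx : IsSystemOfParameters x) (hreg : ∀ a, a * x 0 = 0 → a = 0) :
    hilbertCoeff (Ideal.span (Set.range x)) 0 - colength (limitClosure x) +
      hilbertCoeff (Ideal.span (Set.range x)) 1 = 0 := by
  have hpow : ∀ n a, a * x 0 ^ n = 0 → a = 0 := by
    intro n
    induction n with
    | zero => intro a h; simpa using h
    | succ n ih => intro a h; exact ih a (hreg _ (by rwa [mul_assoc, ← pow_succ]))
  have hQ : Ideal.span (Set.range x) = Ideal.span {x 0} := by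
    rw [Set.range_unique]
    rfl
  have hlim : limitClosure x = Ideal.span {x 0} := by
    refine le_antisymm ?_ (hQ ▸ span_range_le_limitClosure x)
    rintro a ⟨n, hn⟩
    rw [Set.range_unique, Fin.prod_univ_one, Ideal.mem_span_singleton] at hn
    obtain ⟨b, hb⟩ := hn
    have hb' : a * x 0 ^ n = x 0 ^ (n + 1) * b := hb
    have h0 : a - x 0 * b = 0 := hpow n _ (by linear_combination hb')
    exact Ideal.mem_span_singleton.mpr ⟨b, by linear_combination h0⟩
  have hfin : ∀ n, Module.length R (R ⧸ ((⊥ : Ideal R) ⊔ Ideal.span {x 0 ^ n})) ≠ ⊤ := by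
    intro n
    rw [bot_sup_eq, ← Ideal.span_singleton_pow, ← hQ]
    exact hx.length_quotient_pow_ne_top n
  have hlen : ∀ n : ℕ, colength (Ideal.span {x 0} ^ n) = n * colength (Ideal.span {x 0}) := by
    intro n
    induction n with
    | zero => simp [colength_top]
    | succ n ih =>
      have h := colength_sup_span_pow_succ hfin n
      have hcolon : (⊥ : Ideal R).colon {x 0 ^ n} = ⊥ := by
        rw [eq_bot_iff]
        intro a ha
        exact hpow n a (mem_colon_singleton_iff_mul_mem.mp ha)
      rw [hcolon, bot_sup_eq, bot_sup_eq, bot_sup_eq, ← Ideal.span_singleton_pow,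
        ← Ideal.span_singleton_pow, ih] at h
      rw [h]
      push_cast
      ring
  -- Two consecutive values of the linear function `n ℓ(R/Q)` determine `e_0 = ℓ(R/Q)` and `e_1 =
  -- 0`, and here `Q^lim = Q`.
  obtain ⟨n, hn⟩ := Filter.eventually_atTop.mp hx.eventually_colength_eq
  have h1 := hn n le_rfl
  have h2 := hn (n + 1) n.le_succ
  rw [hQ, hlen] at h1 h2
  simp only [Finset.sum_range_succ, Finset.range_zero, Finset.sum_empty, zero_add, pow_zero,
    one_mul, Nat.sub_zero, Nat.choose_one_right, pow_one, Nat.sub_self, add_zero,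
    Nat.choose_zero_right] at h1 h2
  push_cast at h1 h2
  rw [hQ, hlim]
  have h3 : hilbertCoeff (Ideal.span {x 0}) 0 = colength (Ideal.span {x 0}) := by
    linear_combination h1 - h2
  rw [h3] at h1 ⊢
  linear_combination h1

end CohenMacaulay

/-! ### The main theorem -/

theorem lemma3p3 (R : Type*) [CommRing R] [IsLocalRing R] [IsNoetherianRing R]
    (hB : IsBuchsbaum R) (hS2 : SatisfiesSerreS R 2) :
    (∀ (d : ℕ) (x : Fin d → R) (Q : Ideal R), IsSystemOfParameters x →
      Q = Ideal.span (Set.range x) →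
        0 ≤ hilbertCoeff Q 0 - lengthInt R (R ⧸ limitClosure x) + hilbertCoeff Q 1) ∧
    ((∃ (d : ℕ) (x : Fin d → R) (Q : Ideal R), IsSystemOfParameters x ∧
      Q = Ideal.span (Set.range x) ∧
        hilbertCoeff Q 0 - lengthInt R (R ⧸ limitClosure x) + hilbertCoeff Q 1 = 0) →
      IsCohenMacaulayLocal R) := by
  obtain ⟨c, hc⟩ := hB
  have hone : ∀ x : Fin 1 → R, IsSystemOfParameters x → ∀ a, a * x 0 = 0 → a = 0 := by
    intro x hx a ha
    obtain ⟨r, hrm, hr⟩ := exists_regular_of_satisfiesSerreS_of_one_le hS2 hx.1.ge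
    exact eq_zero_of_mul_param_eq_zero hc hx hrm hr 0 ha
  constructor
  · rintro d x _ hx rfl
    match d, x, hx with
    | 0, x, hx => exact (hilbertCoeff_sub_colength_limitClosure_of_dim_zero hx).ge
    | 1, x, hx => exact (hilbertCoeff_sub_colength_limitClosure_of_dim_one hx (hone x hx)).ge
    | D + 2, x, hx =>
      have h1 := colength_colonSup_sup_le hc hx
      have h2 : colength (limitClosure x) ≤ colength (colonSup x 0 ⊔ colonSup x 1) :=
        colength_mono (length_quotient_ne_top_of_le hx.length_quotient_ne_top
        (le_sup_of_le_left le_sup_right))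
        (sup_le (colonSup_le_limitClosure x 0) (colonSup_le_limitClosure x 1))
      change 0 ≤ _ - colength (limitClosure x) + _
      linarith
  · rintro ⟨d, x, _, hx, rfl, heq⟩
    refine isCohenMacaulayLocal_of_forall_mem hx ?_
    match d, x, hx, heq with
    | 0, x, hx, _ => exact fun _ i => i.elim0
    | 1, x, hx, _ =>
      intro J i hi a ha
      have hJ : J = ∅ := Finset.eq_empty_of_forall_notMem fun j hj =>
        hi (Subsingleton.elim j i ▸ hj)
      obtain rfl : i = 0 := Subsingleton.elim _ _
      subst hJ
      simp only [Finset.coe_empty, Set.image_empty, Ideal.span_empty, Ideal.mem_bot] at ha ⊢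
      exact hone x hx a ha
    | D + 2, x, hx, heq =>
      have hdim : 2 ≤ ringKrullDim R := by
        rw [hx.1]
        exact_mod_cast Nat.le_add_left 2 D
      obtain ⟨r, hrm, s, hsm, hr, hs⟩ := exists_regular_of_satisfiesSerreS_of_two_le hS2 hdim
      have heq' : hilbertCoeff (Ideal.span (Set.range x)) 0 +
          hilbertCoeff (Ideal.span (Set.range x)) 1 = colength (limitClosure x) := by
        linear_combination heq
      intro J i hi a ha
      exact mem_span_of_mul_param_mem_of_limitClosure_le hc hx
        (fun _ _ hij => limitClosure_le_colonSup_sup hc hx heq' hij)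
        (mem_span_of_card_lt_two hc hx hrm hsm hr hs) (J.card + 1) J (Nat.lt_succ_self _) i hi a ha
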